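/- Let $\mathbb{F}$ be a field of characteristic $0$. A Poisson algebra is an $\mathbb{F}$-vector space with a commutative associative bilinear product $a\cdot b$ (not necessarily unital) and an anticommutative bilinear bracket $[a,b]$ satisfying the Jacobi identity and $[a,b\cdot c]=[a,b]\cdot c+b\cdot[a,c]$. In every Poisson algebra consider the three ternary operations $$\langle a,b,c\rangle=a\cdot b\cdot c,\qquad (a,b,c)=[a,b]\cdot c,\qquad [a,b,c]=[[a,b],c].$$ A Poisson triple system is an $\mathbb{F}$-vector space with three trilinear operations $\langle a,b,c\rangle$, $(a,b,c)$, $[a,b,c]$ satisfying the symmetries $$\langle a,b,c\rangle=\langle a^\sigma,b^\sigma,c^\sigma\rangle\ (\sigma\in S_3),\quad (a,b,c)+(b,a,c)=0,\quad [a,b,c]+[b,a,c]=0,\quad [a,b,c]+[b,c,a]+[c,a,b]=0$$ and the following nine relations: 1. $\langle\langle a,b,c\rangle,d,e\rangle=\langle a,b,\langle c,d,e\rangle\rangle$; 2. $\langle(a,b,c),d,e\rangle=(a,b,\langle c,d,e\rangle)$; 3. $(a,b,(c,d,e))=(c,d,(a,b,e))$; 4. $\langle[a,b,c],d,e\rangle=((a,b,e),c,d)+(a,b,(c,e,d))$;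 5. $(\langle a,b,c\rangle,d,e)=(a,d,\langle b,c,e\rangle)+(b,d,\langle a,c,e\rangle)+(c,d,\langle a,b,e\rangle)$; 6. $[(a,b,c),d,e]=([a,b,d],e,c)-(a,b,[d,c,e])-(d,c,[a,b,e])-(e,c,[a,b,d])$; 7. $([a,b,c],d,e)=([a,d,b],c,e)-([b,d,a],c,e)-([c,d,a],b,e)+([c,d,b],a,e)$; 8. $[a,b,[c,d,e]]=[[a,b,c],d,e]+[c,[a,b,d],e]+[c,d,[a,b,e]]$; 9. $[\langle a,b,c\rangle,d,e]=((a,d,b),e,c)-(a,d,(e,c,b))+((b,d,a),e,c)-(b,d,(e,c,a))+((c,d,b),e,a)-(c,d,(e,a,b))$. Let $T(5)$ be the multilinear component in five generators $a_1,\dots,a_5$ of the free algebra with three trilinear operations satisfying the symmetries, let $P(5)$ be the multilinear component of the free Poisson algebra on the same generators, and let $R\colon T(5)\to P(5)$ be the expansion map, which replaces each ternary operation by its expression in the Poisson operations. Permuting generators makes $T(5)$ an $S_5$-module; let $N\subseteq T(5)$ be the $S_5$-submodule generated by the nine relations (left side minus right side, with $a,b,c,d,e=a_1,\dots,a_5$).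 **Theorem.** Every relation of degree $5$ satisfied by the three ternary operations in all Poisson algebras is a consequence of the symmetries and the nine relations. Precisely: (a) A multilinear polynomial of degree $5$ in three abstract ternary operations vanishes identically in every Poisson algebra over $\mathbb{F}$ if and only if its class in $T(5)$ lies in $N$. In particular, it then vanishes identically in every Poisson triple system over $\mathbb{F}$. (b) $\ker R=N$. (c) The following $360$ monomials, where $a,b,c,d,e$ runs over the permutations of $a_1,\dots,a_5$ satisfying the stated conditions for the order $a_1\prec\dots\prec a_5$, form a basis of $T(5)$: - $\langle\langle a,b,c\rangle,d,e\rangle$ with $a\prec b\prec c$, $d\prec e$; - $\langle(a,b,c),d,e\rangle$ with $a\prec b$, $d\prec e$; - $\langle[a,b,c],d,e\rangle$ with $a\prec b,c$, $d\prec e$; - $(\langle a,b,c\rangle,d,e)$ with $a\prec b\prec c$; - $(a,b,\langle c,d,e\rangle)$ with $a\prec b$, $c\prec d\prec e$; - $((a,b,c),d,e)$ with $a\prec b$; - $(a,b,(c,d,e))$ with $a\prec b$, $c\prec d$; - $([a,b,c],d,e)$ with $a\prec b,c$; - $(a,b,[c,d,e])$ with $a\prec b$, $c\prec d,e$; - $[\langle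 a,b,c\rangle,d,e]$ with $a\prec b\prec c$; - $[(a,b,c),d,e]$ with $a\prec b$; - $[[a,b,c],d,e]$ with $a\prec b,c$. Likewise the following $120$ monomials form a basis of $P(5)$: - $[[[[a,b],c],d],e]$ with $a\prec b,c,d,e$; - $[[[a,b],c],d]\cdot e$ with $a\prec b,c,d$; - $[[a,b],c]\cdot[d,e]$ with $a\prec b,c$, $d\prec e$; - $[[a,b],c]\cdot d\cdot e$ with $a\prec b,c$, $d\prec e$; - $[a,b]\cdot[c,d]\cdot e$ with $a\prec b$, $c\prec d$, $a\prec c$; - $[a,b]\cdot c\cdot d\cdot e$ with $a\prec b$, $c\prec d\prec e$; - $a\cdot b\cdot c\cdot d\cdot e$ with $a\prec b\prec c\prec d\prec e$. The kernel of the $120\times360$ matrix of $R$ with respect to these bases (the expansion matrix) is the space of coordinate vectors of the elements of $N$. -/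

import Mathlib

universe u v w

namespace PoissonTriple

/-! ## Binary and ternary operations, Poisson algebras, Poisson triple systems -/

/-- Two bilinear operations on a vector space, `mul a b = a · b` and `bracket a b = [a, b]`. -/
structure BinaryOps (F : Type u) (A : Type v) [Field F] [AddCommGroup A] [Module F A] where
  mul : A →ₗ[F] A →ₗ[F] A
  bracket : A →ₗ[F] A →ₗ[F] A

/-- A (not necessarily unital) Poisson algebra structure on a vector space. -/
structure PoissonAlgebra (F : Type u) (A : Type v) [Field F] [AddCommGroup A] [Module F A]
    extends BinaryOps F A where
  mul_comm : ∀ a b, mul a b = mul b a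
  bracket_anticomm : ∀ a b, bracket a b + bracket b a = 0
  mul_assoc : ∀ a b c, mul (mul a b) c = mul a (mul b c)
  jacobi : ∀ a b c,
    bracket (bracket a b) c + bracket (bracket b c) a + bracket (bracket c a) b = 0
  leibniz : ∀ a b c, bracket a (mul b c) = mul (bracket a b) c + mul b (bracket a c)

/-- Three trilinear operations on a vector space:
`f a b c = ⟨a, b, c⟩`, `g a b c = (a, b, c)` and `h a b c = [a, b, c]`. -/
structure TernaryOps (F : Type u) (V : Type v) [Field F] [AddCommGroup V] [Module F V] where
  f : V →ₗ[F] V →ₗ[F] V →ₗ[F] V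
  g : V →ₗ[F] V →ₗ[F] V →ₗ[F] V
  h : V →ₗ[F] V →ₗ[F] V →ₗ[F] V

section Ops

variable {F : Type u} [Field F]

/-- The ternary operations `⟨a,b,c⟩ = (a · b) · c`, `(a,b,c) = [a,b] · c`, `[a,b,c] = [[a,b],c]`
defined by two binary operations. -/
def BinaryOps.toTernary {A : Type v} [AddCommGroup A] [Module F A] (P : BinaryOps F A) :
    TernaryOps F A where
  f := P.mul.compr₂ P.mul
  g := P.bracket.compr₂ P.mul
  h := P.bracket.compr₂ P.bracket

theorem BinaryOps.toTernary_f {A : Type v} [AddCommGroup A] [Module F A] (P : BinaryOps F A)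
    (a b c : A) : P.toTernary.f a b c = P.mul (P.mul a b) c := rfl

theorem BinaryOps.toTernary_g {A : Type v} [AddCommGroup A] [Module F A] (P : BinaryOps F A)
    (a b c : A) : P.toTernary.g a b c = P.mul (P.bracket a b) c := rfl

theorem BinaryOps.toTernary_h {A : Type v} [AddCommGroup A] [Module F A] (P : BinaryOps F A)
    (a b c : A) : P.toTernary.h a b c = P.bracket (P.bracket a b) c := rfl

variable {V : Type v} [AddCommGroup V] [Module F V] {W : Type w} [AddCommGroup W] [Module F W]

/-- The nine defining relations of degree 5 of a Poisson triple system,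
each written as (left side) - (right side). -/
def TernaryOps.relation (T : TernaryOps F V) (i : Fin 9) (a b c d e : V) : V :=
  match i with
  | 0 => T.f (T.f a b c) d e - T.f a b (T.f c d e)
  | 1 => T.f (T.g a b c) d e - T.g a b (T.f c d e)
  | 2 => T.g a b (T.g c d e) - T.g c d (T.g a b e)
  | 3 => T.f (T.h a b c) d e - (T.g (T.g a b e) c d + T.g a b (T.g c e d))
  | 4 => T.g (T.f a b c) d e
      - (T.g a d (T.f b c e) + T.g b d (T.f a c e) + T.g c d (T.f a b e))
  | 5 => T.h (T.g a b c) d e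
      - (T.g (T.h a b d) e c - T.g a b (T.h d c e) - T.g d c (T.h a b e) - T.g e c (T.h a b d))
  | 6 => T.g (T.h a b c) d e
      - (T.g (T.h a d b) c e - T.g (T.h b d a) c e - T.g (T.h c d a) b e + T.g (T.h c d b) a e)
  | 7 => T.h a b (T.h c d e)
      - (T.h (T.h a b c) d e + T.h c (T.h a b d) e + T.h c d (T.h a b e))
  | 8 => T.h (T.f a b c) d e
      - (T.g (T.g a d b) e c - T.g a d (T.g e c b) + T.g (T.g b d a) e c
        - T.g b d (T.g e c a) + T.g (T.g c d b) e a - T.g c d (T.g e a b))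

/-- The symmetries hold modulo the subspace `I`
(the first two express invariance of `f` under all of `S₃`). -/
structure TernaryOps.SymmetriesMod (T : TernaryOps F V) (I : Submodule F V) : Prop where
  f_swap₁₂ : ∀ a b c, T.f a b c - T.f b a c ∈ I
  f_swap₂₃ : ∀ a b c, T.f a b c - T.f a c b ∈ I
  g_anticomm : ∀ a b c, T.g a b c + T.g b a c ∈ I
  h_anticomm : ∀ a b c, T.h a b c + T.h b a c ∈ I
  h_jacobi : ∀ a b c, T.h a b c + T.h b c a + T.h c a b ∈ I

/-- A Poisson triple system: the symmetries and the nine relations hold. -/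
structure TernaryOps.IsPoissonTripleSystem (T : TernaryOps F V) : Prop where
  f_swap₁₂ : ∀ a b c, T.f a b c = T.f b a c
  f_swap₂₃ : ∀ a b c, T.f a b c = T.f a c b
  g_anticomm : ∀ a b c, T.g a b c + T.g b a c = 0
  h_anticomm : ∀ a b c, T.h a b c + T.h b a c = 0
  h_jacobi : ∀ a b c, T.h a b c + T.h b c a + T.h c a b = 0
  relation_eq_zero : ∀ (i : Fin 9) (a b c d e : V), T.relation i a b c d e = 0

/-- `I` is an ideal for the three ternary operations. -/
structure TernaryOps.IsIdeal (T : TernaryOps F V) (I : Submodule F V) : Prop where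
  f_mem : ∀ a b c, a ∈ I ∨ b ∈ I ∨ c ∈ I → T.f a b c ∈ I
  g_mem : ∀ a b c, a ∈ I ∨ b ∈ I ∨ c ∈ I → T.g a b c ∈ I
  h_mem : ∀ a b c, a ∈ I ∨ b ∈ I ∨ c ∈ I → T.h a b c ∈ I

/-- `I` is a (two-sided) ideal for the two binary operations. -/
structure BinaryOps.IsIdeal (P : BinaryOps F V) (I : Submodule F V) : Prop where
  mul_mem : ∀ a b, a ∈ I ∨ b ∈ I → P.mul a b ∈ I
  bracket_mem : ∀ a b, a ∈ I ∨ b ∈ I → P.bracket a b ∈ I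

/-- The Poisson algebra axioms hold modulo the subspace `I`. -/
structure BinaryOps.PoissonMod (P : BinaryOps F V) (I : Submodule F V) : Prop where
  mul_comm : ∀ a b, P.mul a b - P.mul b a ∈ I
  bracket_anticomm : ∀ a b, P.bracket a b + P.bracket b a ∈ I
  mul_assoc : ∀ a b c, P.mul (P.mul a b) c - P.mul a (P.mul b c) ∈ I
  jacobi : ∀ a b c,
    P.bracket (P.bracket a b) c + P.bracket (P.bracket b c) a + P.bracket (P.bracket c a) b ∈ I
  leibniz : ∀ a b c,
    P.bracket a (P.mul b c) - (P.mul (P.bracket a b) c + P.mul b (P.bracket a c)) ∈ I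

/-- A linear map commuting with the ternary operations. -/
structure TernaryOps.IsHom (T : TernaryOps F V) (T' : TernaryOps F W) (φ : V →ₗ[F] W) : Prop where
  map_f : ∀ a b c, φ (T.f a b c) = T'.f (φ a) (φ b) (φ c)
  map_g : ∀ a b c, φ (T.g a b c) = T'.g (φ a) (φ b) (φ c)
  map_h : ∀ a b c, φ (T.h a b c) = T'.h (φ a) (φ b) (φ c)

theorem TernaryOps.IsHom.isIdeal_comap {T : TernaryOps F V} {T' : TernaryOps F W}
    {φ : V →ₗ[F] W} (hφ : T.IsHom T' φ) {I : Submodule F W} (hI : T'.IsIdeal I) :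
    T.IsIdeal (I.comap φ) where
  f_mem a b c h := by
    rw [Submodule.mem_comap, hφ.map_f]; exact hI.f_mem _ _ _ h
  g_mem a b c h := by
    rw [Submodule.mem_comap, hφ.map_g]; exact hI.g_mem _ _ _ h
  h_mem a b c h := by
    rw [Submodule.mem_comap, hφ.map_h]; exact hI.h_mem _ _ _ h

theorem TernaryOps.IsHom.symmetriesMod_comap {T : TernaryOps F V} {T' : TernaryOps F W}
    {φ : V →ₗ[F] W} (hφ : T.IsHom T' φ) {I : Submodule F W} (hI : T'.SymmetriesMod I) :
    T.SymmetriesMod (I.comap φ) where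
  f_swap₁₂ a b c := by
    simpa only [Submodule.mem_comap, map_sub, hφ.map_f] using hI.f_swap₁₂ (φ a) (φ b) (φ c)
  f_swap₂₃ a b c := by
    simpa only [Submodule.mem_comap, map_sub, hφ.map_f] using hI.f_swap₂₃ (φ a) (φ b) (φ c)
  g_anticomm a b c := by
    simpa only [Submodule.mem_comap, map_add, hφ.map_g] using hI.g_anticomm (φ a) (φ b) (φ c)
  h_anticomm a b c := by
    simpa only [Submodule.mem_comap, map_add, hφ.map_h] using hI.h_anticomm (φ a) (φ b) (φ c)
  h_jacobi a b c := by
    simpa only [Submodule.mem_comap, map_add, hφ.map_h] using hI.h_jacobi (φ a) (φ b) (φ c)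

theorem BinaryOps.IsIdeal.toTernary {P : BinaryOps F V} {I : Submodule F V} (hI : P.IsIdeal I) :
    P.toTernary.IsIdeal I where
  f_mem a b c := by
    rintro (h | h | h)
    · exact hI.mul_mem _ _ (Or.inl (hI.mul_mem _ _ (Or.inl h)))
    · exact hI.mul_mem _ _ (Or.inl (hI.mul_mem _ _ (Or.inr h)))
    · exact hI.mul_mem _ _ (Or.inr h)
  g_mem a b c := by
    rintro (h | h | h)
    · exact hI.mul_mem _ _ (Or.inl (hI.bracket_mem _ _ (Or.inl h)))
    · exact hI.mul_mem _ _ (Or.inl (hI.bracket_mem _ _ (Or.inr h)))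
    · exact hI.mul_mem _ _ (Or.inr h)
  h_mem a b c := by
    rintro (h | h | h)
    · exact hI.bracket_mem _ _ (Or.inl (hI.bracket_mem _ _ (Or.inl h)))
    · exact hI.bracket_mem _ _ (Or.inl (hI.bracket_mem _ _ (Or.inr h)))
    · exact hI.bracket_mem _ _ (Or.inr h)

theorem BinaryOps.PoissonMod.toTernary {P : BinaryOps F V} {I : Submodule F V}
    (hP : P.PoissonMod I) (hI : P.IsIdeal I) : P.toTernary.SymmetriesMod I where
  f_swap₁₂ a b c := by
    have h := hI.mul_mem _ c (Or.inl (hP.mul_comm a b))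
    simpa only [BinaryOps.toTernary_f, map_sub, LinearMap.sub_apply] using h
  f_swap₂₃ a b c := by
    have h1 := hP.mul_assoc a b c
    have h2 := hP.mul_assoc a c b
    have h3 := hI.mul_mem a _ (Or.inr (hP.mul_comm b c))
    have h := I.sub_mem (I.add_mem h1 h3) h2
    rw [map_sub] at h
    rw [BinaryOps.toTernary_f, BinaryOps.toTernary_f]
    convert h using 1
    abel
  g_anticomm a b c := by
    have h := hI.mul_mem _ c (Or.inl (hP.bracket_anticomm a b))
    simpa only [BinaryOps.toTernary_g, map_add, LinearMap.add_apply] using h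
  h_anticomm a b c := by
    have h := hI.bracket_mem _ c (Or.inl (hP.bracket_anticomm a b))
    simpa only [BinaryOps.toTernary_h, map_add, LinearMap.add_apply] using h
  h_jacobi a b c := hP.jacobi a b c

end Ops

/-! ## Monomials -/

/-- Monomials in three abstract ternary operations, with variables in `X`:
`f r s t = ⟨r, s, t⟩`, `g r s t = (r, s, t)`, `h r s t = [r, s, t]`. -/
inductive TernaryMonomial (X : Type v) : Type v
  | var (x : X) : TernaryMonomial X
  | f (r s t : TernaryMonomial X) : TernaryMonomial X
  | g (r s t : TernaryMonomial X) : TernaryMonomial X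
  | h (r s t : TernaryMonomial X) : TernaryMonomial X

/-- Monomials in two abstract binary operations, `mul r s = r · s` and `bracket r s = [r, s]`. -/
inductive BinaryMonomial (X : Type v) : Type v
  | var (x : X) : BinaryMonomial X
  | mul (r s : BinaryMonomial X) : BinaryMonomial X
  | bracket (r s : BinaryMonomial X) : BinaryMonomial X

namespace TernaryMonomial

variable {X : Type v} {Y : Type w}

/-- The arguments of a monomial, from left to right. -/
def args : TernaryMonomial X → List X
  | var x => [x]
  | f r s t => r.args ++ s.args ++ t.args
  | g r s t => r.args ++ s.args ++ t.args
  | h r s t => r.args ++ s.args ++ t.args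

/-- Substitution of variables. -/
def rename (σ : X → Y) : TernaryMonomial X → TernaryMonomial Y
  | var x => var (σ x)
  | f r s t => f (r.rename σ) (s.rename σ) (t.rename σ)
  | g r s t => g (r.rename σ) (s.rename σ) (t.rename σ)
  | h r s t => h (r.rename σ) (s.rename σ) (t.rename σ)

/-- A monomial in the variables `a_0, …, a_{n-1}` is multilinear
if each of them occurs in it exactly once. -/
def IsMultilinear {n : ℕ} (m : TernaryMonomial (Fin n)) : Prop :=
  ∀ i, m.args.count i = 1

/-- The value of a monomial at a tuple of elements of a space with three ternary operations. -/
def eval {F : Type u} [Field F] {V : Type w} [AddCommGroup V] [Module F V] (T : TernaryOps F V)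
    (x : X → V) : TernaryMonomial X → V
  | var i => x i
  | f r s t => T.f (r.eval T x) (s.eval T x) (t.eval T x)
  | g r s t => T.g (r.eval T x) (s.eval T x) (t.eval T x)
  | h r s t => T.h (r.eval T x) (s.eval T x) (t.eval T x)

/-- Expansion of a ternary monomial into a binary monomial:
`⟨a,b,c⟩ = (a · b) · c`, `(a,b,c) = [a,b] · c`, `[a,b,c] = [[a,b],c]`. -/
def expand : TernaryMonomial X → BinaryMonomial X
  | var x => .var x
  | f r s t => .mul (.mul r.expand s.expand) t.expand
  | g r s t => .mul (.bracket r.expand s.expand) t.expand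
  | h r s t => .bracket (.bracket r.expand s.expand) t.expand

theorem args_rename (σ : X → Y) (m : TernaryMonomial X) : (m.rename σ).args = m.args.map σ := by
  induction m <;> simp_all [rename, args]

theorem IsMultilinear.rename {n : ℕ} {m : TernaryMonomial (Fin n)} (hm : m.IsMultilinear)
    (σ : Equiv.Perm (Fin n)) : (m.rename σ).IsMultilinear := by
  intro i
  rw [args_rename]
  have h := List.count_map_of_injective m.args σ σ.injective (σ.symm i)
  rw [Equiv.apply_symm_apply] at h
  rw [h]
  exact hm _

end TernaryMonomial

namespace BinaryMonomial

variable {X : Type v} {Y : Type w}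

/-- The arguments of a monomial, from left to right. -/
def args : BinaryMonomial X → List X
  | var x => [x]
  | mul r s => r.args ++ s.args
  | bracket r s => r.args ++ s.args

/-- Substitution of variables. -/
def rename (σ : X → Y) : BinaryMonomial X → BinaryMonomial Y
  | var x => var (σ x)
  | mul r s => mul (r.rename σ) (s.rename σ)
  | bracket r s => bracket (r.rename σ) (s.rename σ)

/-- A monomial in the variables `a_0, …, a_{n-1}` is multilinear
if each of them occurs in it exactly once. -/
def IsMultilinear {n : ℕ} (m : BinaryMonomial (Fin n)) : Prop :=
  ∀ i, m.args.count i = 1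

theorem args_rename (σ : X → Y) (m : BinaryMonomial X) : (m.rename σ).args = m.args.map σ := by
  induction m <;> simp_all [rename, args]

theorem IsMultilinear.rename {n : ℕ} {m : BinaryMonomial (Fin n)} (hm : m.IsMultilinear)
    (σ : Equiv.Perm (Fin n)) : (m.rename σ).IsMultilinear := by
  intro i
  rw [args_rename]
  have h := List.count_map_of_injective m.args σ σ.injective (σ.symm i)
  rw [Equiv.apply_symm_apply] at h
  rw [h]
  exact hm _

end BinaryMonomial

theorem TernaryMonomial.args_expand {X : Type v} (m : TernaryMonomial X) :
    m.expand.args = m.args := by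
  induction m <;> simp_all [expand, args, BinaryMonomial.args]

noncomputable section

/-! ## Free algebras -/

section Free

variable (F : Type u) [Field F]

/-- The bilinear extension of a binary operation on a basis. -/
def bilinearExt {α : Type v} (op : α → α → α) : (α →₀ F) →ₗ[F] (α →₀ F) →ₗ[F] (α →₀ F) :=
  Finsupp.linearCombination F fun r =>
    Finsupp.linearCombination F fun s => Finsupp.single (op r s) (1 : F)

/-- The trilinear extension of a ternary operation on a basis. -/
def trilinearExt {α : Type v} (op : α → α → α → α) :
    (α →₀ F) →ₗ[F] (α →₀ F) →ₗ[F] (α →₀ F) →ₗ[F] (α →₀ F) :=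
  Finsupp.linearCombination F fun r =>
    Finsupp.linearCombination F fun s =>
      Finsupp.linearCombination F fun t => Finsupp.single (op r s t) (1 : F)

theorem bilinearExt_single {α : Type v} (op : α → α → α) (r s : α) (x y : F) :
    bilinearExt F op (.single r x) (.single s y) = .single (op r s) (x * y) := by
  simp [bilinearExt]

theorem trilinearExt_single {α : Type v} (op : α → α → α → α) (r s t : α) (x y z : F) :
    trilinearExt F op (.single r x) (.single s y) (.single t z)
      = .single (op r s t) (x * y * z) := by
  simp [trilinearExt, Finsupp.linearCombination_single, Finsupp.smul_single, -Finsupp.single_mul,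
    mul_assoc]

/-- The free algebra on `X` with two bilinear operations (and no axioms). -/
def freeBinaryOps (X : Type v) : BinaryOps F (BinaryMonomial X →₀ F) where
  mul := bilinearExt F .mul
  bracket := bilinearExt F .bracket

/-- The free algebra on `X` with three trilinear operations (and no axioms). -/
def freeTernaryOps (X : Type v) : TernaryOps F (TernaryMonomial X →₀ F) where
  f := trilinearExt F .f
  g := trilinearExt F .g
  h := trilinearExt F .h

/-- The smallest ideal modulo which the axioms of Poisson algebras hold. -/
def poissonIdeal (X : Type v) : Submodule F (BinaryMonomial X →₀ F) :=
  sInf {I | (freeBinaryOps F X).IsIdeal I ∧ (freeBinaryOps F X).PoissonMod I}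

/-- The smallest ideal modulo which the symmetries of the ternary operations hold. -/
def symmetryIdeal (X : Type v) : Submodule F (TernaryMonomial X →₀ F) :=
  sInf {I | (freeTernaryOps F X).IsIdeal I ∧ (freeTernaryOps F X).SymmetriesMod I}

/-- The free Poisson algebra generated by `X`. -/
abbrev FreePoisson (X : Type v) : Type (max u v) :=
  (BinaryMonomial X →₀ F) ⧸ poissonIdeal F X

/-- The free algebra on `X` with three trilinear operations satisfying the symmetries. -/
abbrev FreeTernary (X : Type v) : Type (max u v) :=
  (TernaryMonomial X →₀ F) ⧸ symmetryIdeal F X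

theorem poissonIdeal_isIdeal (X : Type v) :
    (freeBinaryOps F X).IsIdeal (poissonIdeal F X) where
  mul_mem a b h := by
    simp only [poissonIdeal, Submodule.mem_sInf] at h ⊢
    intro I hI
    exact hI.1.mul_mem a b (h.imp (fun h => h I hI) fun h => h I hI)
  bracket_mem a b h := by
    simp only [poissonIdeal, Submodule.mem_sInf] at h ⊢
    intro I hI
    exact hI.1.bracket_mem a b (h.imp (fun h => h I hI) fun h => h I hI)

theorem poissonIdeal_poissonMod (X : Type v) :
    (freeBinaryOps F X).PoissonMod (poissonIdeal F X) where
  mul_comm a b := Submodule.mem_sInf.2 fun _ hI => hI.2.mul_comm a b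
  bracket_anticomm a b := Submodule.mem_sInf.2 fun _ hI => hI.2.bracket_anticomm a b
  mul_assoc a b c := Submodule.mem_sInf.2 fun _ hI => hI.2.mul_assoc a b c
  jacobi a b c := Submodule.mem_sInf.2 fun _ hI => hI.2.jacobi a b c
  leibniz a b c := Submodule.mem_sInf.2 fun _ hI => hI.2.leibniz a b c

theorem symmetryIdeal_isIdeal (X : Type v) :
    (freeTernaryOps F X).IsIdeal (symmetryIdeal F X) where
  f_mem a b c h := by
    simp only [symmetryIdeal, Submodule.mem_sInf] at h ⊢
    intro I hI
    exact hI.1.f_mem a b c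
      (h.imp (fun h => h I hI) fun h => h.imp (fun h => h I hI) fun h => h I hI)
  g_mem a b c h := by
    simp only [symmetryIdeal, Submodule.mem_sInf] at h ⊢
    intro I hI
    exact hI.1.g_mem a b c
      (h.imp (fun h => h I hI) fun h => h.imp (fun h => h I hI) fun h => h I hI)
  h_mem a b c h := by
    simp only [symmetryIdeal, Submodule.mem_sInf] at h ⊢
    intro I hI
    exact hI.1.h_mem a b c
      (h.imp (fun h => h I hI) fun h => h.imp (fun h => h I hI) fun h => h I hI)

theorem symmetryIdeal_symmetriesMod (X : Type v) :
    (freeTernaryOps F X).SymmetriesMod (symmetryIdeal F X) where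
  f_swap₁₂ a b c := Submodule.mem_sInf.2 fun _ hI => hI.2.f_swap₁₂ a b c
  f_swap₂₃ a b c := Submodule.mem_sInf.2 fun _ hI => hI.2.f_swap₂₃ a b c
  g_anticomm a b c := Submodule.mem_sInf.2 fun _ hI => hI.2.g_anticomm a b c
  h_anticomm a b c := Submodule.mem_sInf.2 fun _ hI => hI.2.h_anticomm a b c
  h_jacobi a b c := Submodule.mem_sInf.2 fun _ hI => hI.2.h_jacobi a b c

theorem trilinear_ext {α : Type v} {W : Type w} [AddCommGroup W] [Module F W]
    (op : α → α → α → α) (φ : (α →₀ F) →ₗ[F] W) (B : W →ₗ[F] W →ₗ[F] W →ₗ[F] W)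
    (H : ∀ r s t, φ (.single (op r s t) 1)
      = B (φ (.single r 1)) (φ (.single s 1)) (φ (.single t 1)))
    (a b c : α →₀ F) : φ (trilinearExt F op a b c) = B (φ a) (φ b) (φ c) := by
  induction a using Finsupp.induction_linear with
  | zero => simp
  | add a₁ a₂ h₁ h₂ => simp only [map_add, LinearMap.add_apply, h₁, h₂]
  | single r x =>
    induction b using Finsupp.induction_linear with
    | zero => simp
    | add a₁ a₂ h₁ h₂ => simp only [map_add, LinearMap.add_apply, h₁, h₂]
    | single s y =>
      induction c using Finsupp.induction_linear with
      | zero => simp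
      | add a₁ a₂ h₁ h₂ => simp only [map_add, h₁, h₂]
      | single t z =>
        have e : ∀ (m : α) (k : F), (Finsupp.single m k : α →₀ F) = k • Finsupp.single m 1 := by
          intro m k; simp
        rw [trilinearExt_single, e (op r s t), e r, e s, e t]
        simp only [map_smul, LinearMap.smul_apply, H, smul_smul]
        congr 1
        ring

theorem rename_isHom {X : Type v} {Y : Type w} (σ : X → Y) :
    (freeTernaryOps F X).IsHom (freeTernaryOps F Y)
      (Finsupp.lmapDomain F F (TernaryMonomial.rename σ)) where
  map_f a b c := trilinear_ext F _ _ _ (by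
    intro r s t
    simp [freeTernaryOps, trilinearExt_single, Finsupp.mapDomain_single,
      TernaryMonomial.rename]) a b c
  map_g a b c := trilinear_ext F _ _ _ (by
    intro r s t
    simp [freeTernaryOps, trilinearExt_single, Finsupp.mapDomain_single,
      TernaryMonomial.rename]) a b c
  map_h a b c := trilinear_ext F _ _ _ (by
    intro r s t
    simp [freeTernaryOps, trilinearExt_single, Finsupp.mapDomain_single,
      TernaryMonomial.rename]) a b c

theorem expand_isHom (X : Type v) :
    (freeTernaryOps F X).IsHom (freeBinaryOps F X).toTernary
      (Finsupp.lmapDomain F F (TernaryMonomial.expand (X := X))) where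
  map_f a b c := trilinear_ext F _ _ _ (by
    intro r s t
    simp [freeBinaryOps, BinaryOps.toTernary_f, bilinearExt_single, Finsupp.mapDomain_single,
      TernaryMonomial.expand]) a b c
  map_g a b c := trilinear_ext F _ _ _ (by
    intro r s t
    simp [freeBinaryOps, BinaryOps.toTernary_g, bilinearExt_single, Finsupp.mapDomain_single,
      TernaryMonomial.expand]) a b c
  map_h a b c := trilinear_ext F _ _ _ (by
    intro r s t
    simp [freeBinaryOps, BinaryOps.toTernary_h, bilinearExt_single, Finsupp.mapDomain_single,
      TernaryMonomial.expand]) a b c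

theorem symmetryIdeal_le_comap_rename {X : Type v} {Y : Type w} (σ : X → Y) :
    symmetryIdeal F X ≤
      (symmetryIdeal F Y).comap (Finsupp.lmapDomain F F (TernaryMonomial.rename σ)) :=
  sInf_le ⟨(rename_isHom F σ).isIdeal_comap (symmetryIdeal_isIdeal F Y),
    (rename_isHom F σ).symmetriesMod_comap (symmetryIdeal_symmetriesMod F Y)⟩

theorem symmetryIdeal_le_comap_expand (X : Type v) :
    symmetryIdeal F X ≤
      (poissonIdeal F X).comap (Finsupp.lmapDomain F F (TernaryMonomial.expand (X := X))) :=
  sInf_le ⟨(expand_isHom F X).isIdeal_comap (poissonIdeal_isIdeal F X).toTernary,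
    (expand_isHom F X).symmetriesMod_comap
      ((poissonIdeal_poissonMod F X).toTernary (poissonIdeal_isIdeal F X))⟩

/-- Substitution of variables in the free algebra with symmetries. -/
def renameMap {X : Type v} {Y : Type w} (σ : X → Y) : FreeTernary F X →ₗ[F] FreeTernary F Y :=
  Submodule.mapQ _ _ (Finsupp.lmapDomain F F (TernaryMonomial.rename σ))
    (symmetryIdeal_le_comap_rename F σ)

/-- The linear map from the free algebra with symmetries to the free Poisson algebra
which expands the ternary operations. -/
def expandMap (X : Type v) : FreeTernary F X →ₗ[F] FreePoisson F X :=
  Submodule.mapQ _ _ (Finsupp.lmapDomain F F (TernaryMonomial.expand (X := X)))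
    (symmetryIdeal_le_comap_expand F X)

/-- The class of a ternary monomial in the free algebra with symmetries. -/
def ternaryClass {X : Type v} (m : TernaryMonomial X) : FreeTernary F X :=
  (symmetryIdeal F X).mkQ (.single m 1)

/-- The class of a binary monomial in the free Poisson algebra. -/
def poissonClass {X : Type v} (m : BinaryMonomial X) : FreePoisson F X :=
  (poissonIdeal F X).mkQ (.single m 1)

theorem renameMap_ternaryClass {X : Type v} {Y : Type w} (σ : X → Y) (m : TernaryMonomial X) :
    renameMap F σ (ternaryClass F m) = ternaryClass F (m.rename σ) := by
  simp [renameMap, ternaryClass]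

theorem expandMap_ternaryClass {X : Type v} (m : TernaryMonomial X) :
    expandMap F X (ternaryClass F m) = poissonClass F m.expand := by
  simp [expandMap, ternaryClass, poissonClass]

/-! ## Multilinear components -/

/-- Multilinear polynomials in `n` variables in three abstract ternary operations. -/
def multilinearPoly (n : ℕ) : Submodule F (TernaryMonomial (Fin n) →₀ F) :=
  Finsupp.supported F F {m | m.IsMultilinear}

/-- `T(n)`: the multilinear component of the free algebra on `n` generators with three
trilinear operations satisfying the symmetries. -/
def multilinearT (n : ℕ) : Submodule F (FreeTernary F (Fin n)) :=
  Submodule.span F {x | ∃ m : TernaryMonomial (Fin n), m.IsMultilinear ∧ x = ternaryClass F m}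

/-- `P(n)`: the multilinear component of the free Poisson algebra on `n` generators. -/
def multilinearP (n : ℕ) : Submodule F (FreePoisson F (Fin n)) :=
  Submodule.span F {x | ∃ m : BinaryMonomial (Fin n), m.IsMultilinear ∧ x = poissonClass F m}

theorem renameMap_mem {n : ℕ} (σ : Equiv.Perm (Fin n)) :
    ∀ x ∈ multilinearT F n, renameMap F σ x ∈ multilinearT F n := by
  change multilinearT F n ≤ (multilinearT F n).comap (renameMap F σ)
  refine Submodule.span_le.2 ?_
  rintro _ ⟨m, hm, rfl⟩
  refine Submodule.subset_span ⟨m.rename σ, hm.rename σ, ?_⟩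
  exact renameMap_ternaryClass F σ m

theorem expandMap_mem {n : ℕ} :
    ∀ x ∈ multilinearT F n, expandMap F (Fin n) x ∈ multilinearP F n := by
  change multilinearT F n ≤ (multilinearP F n).comap (expandMap F (Fin n))
  refine Submodule.span_le.2 ?_
  rintro _ ⟨m, hm, rfl⟩
  refine Submodule.subset_span ⟨m.expand, ?_, expandMap_ternaryClass F m⟩
  intro i
  rw [TernaryMonomial.args_expand]
  exact hm i

/-- The action of the symmetric group `S_n` on `T(n)` by permuting the variables. -/
def permute {n : ℕ} (σ : Equiv.Perm (Fin n)) : multilinearT F n →ₗ[F] multilinearT F n :=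
  (renameMap F σ).restrict (renameMap_mem F σ)

/-- The expansion map `R : T(n) → P(n)`. -/
def expansion (n : ℕ) : multilinearT F n →ₗ[F] multilinearP F n :=
  (expandMap F (Fin n)).restrict (expandMap_mem F)

/-- The class of a multilinear ternary monomial in `T(n)`. -/
def monomialT {n : ℕ} (m : TernaryMonomial (Fin n)) (hm : m.IsMultilinear) : multilinearT F n :=
  ⟨ternaryClass F m, Submodule.subset_span ⟨m, hm, rfl⟩⟩

/-- The class of a multilinear binary monomial in `P(n)`. -/
def monomialP {n : ℕ} (m : BinaryMonomial (Fin n)) (hm : m.IsMultilinear) : multilinearP F n :=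
  ⟨poissonClass F m, Submodule.subset_span ⟨m, hm, rfl⟩⟩

theorem mkQ_mem_multilinearT {n : ℕ} (p : TernaryMonomial (Fin n) →₀ F)
    (hp : p ∈ multilinearPoly F n) : (symmetryIdeal F (Fin n)).mkQ p ∈ multilinearT F n := by
  have h : multilinearPoly F n ≤ (multilinearT F n).comap (symmetryIdeal F (Fin n)).mkQ := by
    rw [multilinearPoly, Finsupp.supported_eq_span_single]
    refine Submodule.span_le.2 ?_
    rintro _ ⟨m, hm, rfl⟩
    exact Submodule.subset_span ⟨m, hm, rfl⟩
  exact h hp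

/-- The class in `T(n)` of a multilinear polynomial. -/
def classT (n : ℕ) : multilinearPoly F n →ₗ[F] multilinearT F n :=
  (symmetryIdeal F (Fin n)).mkQ.restrict (mkQ_mem_multilinearT F)

/-! ## The relations in degree 5 -/

/-- The nine relations as polynomials in the variables `a, b, c, d, e = a_0, a_1, a_2, a_3, a_4`. -/
def relationPoly (i : Fin 9) : TernaryMonomial (Fin 5) →₀ F :=
  (freeTernaryOps F (Fin 5)).relation i (.single (.var 0) 1) (.single (.var 1) 1)
    (.single (.var 2) 1) (.single (.var 3) 1) (.single (.var 4) 1)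

theorem relationPoly_mem (i : Fin 9) : relationPoly F i ∈ multilinearPoly F 5 := by
  have key : ∀ m : TernaryMonomial (Fin 5), m.IsMultilinear →
      (Finsupp.single m 1 : TernaryMonomial (Fin 5) →₀ F) ∈ multilinearPoly F 5 :=
    fun m hm => Finsupp.single_mem_supported F 1 hm
  fin_cases i <;>
    simp only [relationPoly, TernaryOps.relation, freeTernaryOps, trilinearExt_single, mul_one] <;>
    repeat' first
      | refine Submodule.sub_mem _ ?_ ?_
      | refine Submodule.add_mem _ ?_ ?_
      | (refine key _ ?_; unfold TernaryMonomial.IsMultilinear; decide)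

/-- The nine relations as elements of `T(5)`. -/
def relationT (i : Fin 9) : multilinearT F 5 :=
  classT F 5 ⟨relationPoly F i, relationPoly_mem F i⟩

/-- The `S_5`-submodule of `T(5)` generated by the nine relations. -/
def relationModule : Submodule F (multilinearT F 5) :=
  Submodule.span F {x | ∃ (σ : Equiv.Perm (Fin 5)) (i : Fin 9), x = permute F σ (relationT F i)}

end Free

/-- `p = 0` is an identity for the given ternary operations. -/
def TernaryOps.Satisfies {F : Type u} [Field F] {V : Type v} [AddCommGroup V] [Module F V]
    (T : TernaryOps F V) {X : Type w} (p : TernaryMonomial X →₀ F) : Prop :=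
  ∀ x : X → V, Finsupp.linearCombination F (TernaryMonomial.eval T x) p = 0

/-! ## Tables of monomials in degree 5 -/

/-- The 12 association types for the three ternary operations in degree 5. -/
def ternaryType : Fin 12 → TernaryMonomial (Fin 5) := fun i =>
  match i with
  | 0 => .f (.f (.var 0) (.var 1) (.var 2)) (.var 3) (.var 4)
  | 1 => .f (.g (.var 0) (.var 1) (.var 2)) (.var 3) (.var 4)
  | 2 => .f (.h (.var 0) (.var 1) (.var 2)) (.var 3) (.var 4)
  | 3 => .g (.f (.var 0) (.var 1) (.var 2)) (.var 3) (.var 4)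
  | 4 => .g (.var 0) (.var 1) (.f (.var 2) (.var 3) (.var 4))
  | 5 => .g (.g (.var 0) (.var 1) (.var 2)) (.var 3) (.var 4)
  | 6 => .g (.var 0) (.var 1) (.g (.var 2) (.var 3) (.var 4))
  | 7 => .g (.h (.var 0) (.var 1) (.var 2)) (.var 3) (.var 4)
  | 8 => .g (.var 0) (.var 1) (.h (.var 2) (.var 3) (.var 4))
  | 9 => .h (.f (.var 0) (.var 1) (.var 2)) (.var 3) (.var 4)
  | 10 => .h (.g (.var 0) (.var 1) (.var 2)) (.var 3) (.var 4)
  | 11 => .h (.h (.var 0) (.var 1) (.var 2)) (.var 3) (.var 4)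

/-- The order conditions on the permuted arguments for the 12 ternary association types. -/
def ternaryOrder (i : Fin 12) (σ : Equiv.Perm (Fin 5)) : Bool :=
  match i with
  | 0 => σ 0 < σ 1 && σ 1 < σ 2 && σ 3 < σ 4
  | 1 => σ 0 < σ 1 && σ 3 < σ 4
  | 2 => σ 0 < σ 1 && σ 0 < σ 2 && σ 3 < σ 4
  | 3 => σ 0 < σ 1 && σ 1 < σ 2
  | 4 => σ 0 < σ 1 && σ 2 < σ 3 && σ 3 < σ 4
  | 5 => σ 0 < σ 1
  | 6 => σ 0 < σ 1 && σ 2 < σ 3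
  | 7 => σ 0 < σ 1 && σ 0 < σ 2
  | 8 => σ 0 < σ 1 && σ 2 < σ 3 && σ 2 < σ 4
  | 9 => σ 0 < σ 1 && σ 1 < σ 2
  | 10 => σ 0 < σ 1
  | 11 => σ 0 < σ 1 && σ 0 < σ 2

/-- The 7 association types for multilinear Poisson monomials in degree 5. -/
def poissonType : Fin 7 → BinaryMonomial (Fin 5) := fun i =>
  match i with
  | 0 => .bracket (.bracket (.bracket (.bracket (.var 0) (.var 1)) (.var 2)) (.var 3)) (.var 4)
  | 1 => .mul (.bracket (.bracket (.bracket (.var 0) (.var 1)) (.var 2)) (.var 3)) (.var 4)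
  | 2 => .mul (.bracket (.bracket (.var 0) (.var 1)) (.var 2)) (.bracket (.var 3) (.var 4))
  | 3 => .mul (.mul (.bracket (.bracket (.var 0) (.var 1)) (.var 2)) (.var 3)) (.var 4)
  | 4 => .mul (.mul (.bracket (.var 0) (.var 1)) (.bracket (.var 2) (.var 3))) (.var 4)
  | 5 => .mul (.mul (.mul (.bracket (.var 0) (.var 1)) (.var 2)) (.var 3)) (.var 4)
  | 6 => .mul (.mul (.mul (.mul (.var 0) (.var 1)) (.var 2)) (.var 3)) (.var 4)

/-- The order conditions on the permuted arguments for the 7 Poisson association types. -/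
def poissonOrder (i : Fin 7) (σ : Equiv.Perm (Fin 5)) : Bool :=
  match i with
  | 0 => σ 0 < σ 1 && σ 0 < σ 2 && σ 0 < σ 3 && σ 0 < σ 4
  | 1 => σ 0 < σ 1 && σ 0 < σ 2 && σ 0 < σ 3
  | 2 => σ 0 < σ 1 && σ 0 < σ 2 && σ 3 < σ 4
  | 3 => σ 0 < σ 1 && σ 0 < σ 2 && σ 3 < σ 4
  | 4 => σ 0 < σ 1 && σ 2 < σ 3 && σ 0 < σ 2
  | 5 => σ 0 < σ 1 && σ 2 < σ 3 && σ 3 < σ 4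
  | 6 => σ 0 < σ 1 && σ 1 < σ 2 && σ 2 < σ 3 && σ 3 < σ 4

/-- Indices of the multilinear ternary monomials in the table. -/
abbrev TernaryIndex : Type := {x : Fin 12 × Equiv.Perm (Fin 5) // ternaryOrder x.1 x.2 = true}

/-- Indices of the multilinear Poisson monomials in the table. -/
abbrev PoissonIndex : Type := {x : Fin 7 × Equiv.Perm (Fin 5) // poissonOrder x.1 x.2 = true}

theorem ternaryType_isMultilinear (i : Fin 12) : (ternaryType i).IsMultilinear := by
  unfold TernaryMonomial.IsMultilinear
  revert i
  decide

theorem poissonType_isMultilinear (i : Fin 7) : (poissonType i).IsMultilinear := by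
  unfold BinaryMonomial.IsMultilinear
  revert i
  decide

/-- The multilinear ternary monomials in the table: in the association type `i`,
the `k`-th argument is the variable with number `σ k`. -/
def tableT (F : Type u) [Field F] (j : TernaryIndex) : multilinearT F 5 :=
  monomialT F ((ternaryType j.1.1).rename j.1.2) ((ternaryType_isMultilinear j.1.1).rename j.1.2)

/-- The multilinear Poisson monomials in the table. -/
def tableP (F : Type u) [Field F] (i : PoissonIndex) : multilinearP F 5 :=
  monomialP F ((poissonType i.1.1).rename i.1.2) ((poissonType_isMultilinear i.1.1).rename i.1.2)

end

end PoissonTriple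

/-! One inclusion is a verification: the nine relations hold in every Poisson algebra, in particular
in the free one, so the expansion map R kills N.

For the other inclusion no 120 × 360 matrix is reduced. For each of the 120 monomials of the Poisson
table a ternary monomial expanding to it is chosen (`poissonLift`). The symmetries and the relations
then serve as reduction rules: modulo N, each of the twelve association types is carried into the
span of these 120 lifts, so T(5) = N + span of the lifts (`relationModule_sup_span_liftP`). If z = n
+ Σ c_j lift_j lies in ker R, applying R gives Σ c_j p_j = 0 with p_j in the Poisson table. Linear
independence of that table forces c = 0 and z ∈ N (`ker_expansion`).

Independence of the Poisson table comes from a model: polynomials in variables X_w indexed by words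
w, with bracket [X_u, X_v] = X_{uv} - X_{vu}. A left-normed Lie monomial in distinct letters
starting with its least letter a has exactly one word starting with a in its expansion. Killing
every word that does not start with its least letter therefore sends the table to distinct
commutative monomials. Spanning is the rewriting to products of left-normed Lie monomials with the
least letter first.

Independence of the ternary table comes from another model: on the span of all ternary monomials,
the operations sort their arguments, so that each table monomial evaluates to itself. Spanning is
again sorting by the symmetries.

Part (a) follows from part (b), since evaluation of a ternary polynomial in a Poisson algebra
factors through R, and the generators of the free Poisson algebra form a generic tuple. -/

namespace PoissonTriple

/-! ### Operations on quotients by ideals -/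

section Quotient

variable {F : Type u} [Field F] {V : Type v} [AddCommGroup V] [Module F V]

/-- A linear section of the projection onto a quotient space. -/
noncomputable def quotientSection (I : Submodule F V) : (V ⧸ I) →ₗ[F] V :=
  (I.mkQ.exists_rightInverse_of_surjective I.range_mkQ).choose

theorem mkQ_quotientSection (I : Submodule F V) (x : V ⧸ I) :
    I.mkQ (quotientSection I x) = x :=
  LinearMap.congr_fun (I.mkQ.exists_rightInverse_of_surjective I.range_mkQ).choose_spec x

theorem quotientSection_mkQ_sub_mem (I : Submodule F V) (a : V) :
    quotientSection I (I.mkQ a) - a ∈ I := by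
  rw [← Submodule.ker_mkQ I, LinearMap.mem_ker, map_sub, Submodule.ker_mkQ,
    mkQ_quotientSection, sub_self]

/-- A bilinear operation induced on a quotient space. -/
noncomputable def quotientBilinear (I : Submodule F V) (B : V →ₗ[F] V →ₗ[F] V) :
    (V ⧸ I) →ₗ[F] (V ⧸ I) →ₗ[F] (V ⧸ I) :=
  (B.compl₁₂ (quotientSection I) (quotientSection I)).compr₂ I.mkQ

/-- The section changes `a` and `b` only by elements of `I`, and B a' b' - B a b = B (a' - a) b' + B
a (b' - b) has both terms in `I`. The ideal property enters only here, since the quotient operation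
itself is defined for every subspace. -/
theorem quotientBilinear_mkQ {I : Submodule F V} {B : V →ₗ[F] V →ₗ[F] V}
    (hB : ∀ a b, a ∈ I ∨ b ∈ I → B a b ∈ I) (a b : V) :
    quotientBilinear I B (I.mkQ a) (I.mkQ b) = I.mkQ (B a b) := by
  change I.mkQ (B (quotientSection I (I.mkQ a)) (quotientSection I (I.mkQ b))) = _
  rw [← sub_eq_zero, ← map_sub, ← LinearMap.mem_ker, Submodule.ker_mkQ]
  have h1 := hB _ (quotientSection I (I.mkQ b)) (Or.inl (quotientSection_mkQ_sub_mem I a))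
  have h2 := hB a _ (Or.inr (quotientSection_mkQ_sub_mem I b))
  have h := I.add_mem h1 h2
  simp only [map_sub, LinearMap.sub_apply, sub_add_sub_cancel] at h
  exact h

/-- A trilinear operation induced on a quotient space. -/
noncomputable def quotientTrilinear (I : Submodule F V) (B : V →ₗ[F] V →ₗ[F] V →ₗ[F] V) :
    (V ⧸ I) →ₗ[F] (V ⧸ I) →ₗ[F] (V ⧸ I) →ₗ[F] (V ⧸ I) :=
  (B.compl₁₂ (quotientSection I) (quotientSection I)).compr₂
    ((LinearMap.lcomp F (V ⧸ I) (quotientSection I)).comp (LinearMap.compRight F I.mkQ))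

theorem quotientTrilinear_mkQ {I : Submodule F V} {B : V →ₗ[F] V →ₗ[F] V →ₗ[F] V}
    (hB : ∀ a b c, a ∈ I ∨ b ∈ I ∨ c ∈ I → B a b c ∈ I) (a b c : V) :
    quotientTrilinear I B (I.mkQ a) (I.mkQ b) (I.mkQ c) = I.mkQ (B a b c) := by
  change I.mkQ (B (quotientSection I (I.mkQ a)) (quotientSection I (I.mkQ b))
    (quotientSection I (I.mkQ c))) = _
  rw [← sub_eq_zero, ← map_sub, ← LinearMap.mem_ker, Submodule.ker_mkQ]
  have h1 := hB _ (quotientSection I (I.mkQ b)) (quotientSection I (I.mkQ c))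
    (Or.inl (quotientSection_mkQ_sub_mem I a))
  have h2 := hB a _ (quotientSection I (I.mkQ c))
    (Or.inr (Or.inl (quotientSection_mkQ_sub_mem I b)))
  have h3 := hB a b _ (Or.inr (Or.inr (quotientSection_mkQ_sub_mem I c)))
  have h := I.add_mem (I.add_mem h1 h2) h3
  simp only [map_sub, LinearMap.sub_apply, sub_add_sub_cancel] at h
  exact h

/-- The binary operations induced on the quotient by an ideal. -/
noncomputable def BinaryOps.quotient (P : BinaryOps F V) (I : Submodule F V) :
    BinaryOps F (V ⧸ I) where
  mul := quotientBilinear I P.mul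
  bracket := quotientBilinear I P.bracket

/-- The ternary operations induced on the quotient by an ideal. -/
noncomputable def TernaryOps.quotient (T : TernaryOps F V) (I : Submodule F V) :
    TernaryOps F (V ⧸ I) where
  f := quotientTrilinear I T.f
  g := quotientTrilinear I T.g
  h := quotientTrilinear I T.h

theorem TernaryOps.IsIdeal.isHom_mkQ {T : TernaryOps F V} {I : Submodule F V} (hI : T.IsIdeal I) :
    T.IsHom (T.quotient I) I.mkQ where
  map_f a b c := (quotientTrilinear_mkQ hI.f_mem a b c).symm
  map_g a b c := (quotientTrilinear_mkQ hI.g_mem a b c).symm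
  map_h a b c := (quotientTrilinear_mkQ hI.h_mem a b c).symm

/-- The quotient by an ideal modulo which the axioms of Poisson algebras hold. -/
noncomputable def PoissonAlgebra.ofQuotient {P : BinaryOps F V} {I : Submodule F V}
    (hI : P.IsIdeal I) (hP : P.PoissonMod I) : PoissonAlgebra F (V ⧸ I) where
  toBinaryOps := P.quotient I
  mul_comm a b := by
    obtain ⟨a, rfl⟩ := I.mkQ_surjective a
    obtain ⟨b, rfl⟩ := I.mkQ_surjective b
    have h := hP.mul_comm a b
    rw [← Submodule.ker_mkQ I, LinearMap.mem_ker] at h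
    simpa only [BinaryOps.quotient, quotientBilinear_mkQ hI.mul_mem, map_sub, sub_eq_zero,
      Submodule.ker_mkQ] using h
  bracket_anticomm a b := by
    obtain ⟨a, rfl⟩ := I.mkQ_surjective a
    obtain ⟨b, rfl⟩ := I.mkQ_surjective b
    have h := hP.bracket_anticomm a b
    rw [← Submodule.ker_mkQ I, LinearMap.mem_ker] at h
    simpa only [BinaryOps.quotient, quotientBilinear_mkQ hI.bracket_mem, map_add,
      Submodule.ker_mkQ] using h
  mul_assoc a b c := by
    obtain ⟨a, rfl⟩ := I.mkQ_surjective a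
    obtain ⟨b, rfl⟩ := I.mkQ_surjective b
    obtain ⟨c, rfl⟩ := I.mkQ_surjective c
    have h := hP.mul_assoc a b c
    rw [← Submodule.ker_mkQ I, LinearMap.mem_ker] at h
    simpa only [BinaryOps.quotient, quotientBilinear_mkQ hI.mul_mem, map_sub, sub_eq_zero,
      Submodule.ker_mkQ] using h
  jacobi a b c := by
    obtain ⟨a, rfl⟩ := I.mkQ_surjective a
    obtain ⟨b, rfl⟩ := I.mkQ_surjective b
    obtain ⟨c, rfl⟩ := I.mkQ_surjective c
    have h := hP.jacobi a b c
    rw [← Submodule.ker_mkQ I, LinearMap.mem_ker] at h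
    simpa only [BinaryOps.quotient, quotientBilinear_mkQ hI.bracket_mem, map_add,
      Submodule.ker_mkQ] using h
  leibniz a b c := by
    obtain ⟨a, rfl⟩ := I.mkQ_surjective a
    obtain ⟨b, rfl⟩ := I.mkQ_surjective b
    obtain ⟨c, rfl⟩ := I.mkQ_surjective c
    have h := hP.leibniz a b c
    rw [← Submodule.ker_mkQ I, LinearMap.mem_ker, map_sub, sub_eq_zero] at h
    simpa only [BinaryOps.quotient, quotientBilinear_mkQ hI.bracket_mem,
      quotientBilinear_mkQ hI.mul_mem, map_add, Submodule.ker_mkQ] using h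

end Quotient

/-! ### Ternary operations satisfying the symmetries exactly -/

section Symmetric

variable {F : Type u} [Field F] {V : Type v} [AddCommGroup V] [Module F V]

/-- The symmetries of the ternary operations hold. -/
structure TernaryOps.IsSymmetric (T : TernaryOps F V) : Prop where
  f_swap₁₂ : ∀ a b c, T.f a b c = T.f b a c
  f_swap₂₃ : ∀ a b c, T.f a b c = T.f a c b
  g_swap : ∀ a b c, T.g a b c = -T.g b a c
  h_swap : ∀ a b c, T.h a b c = -T.h b a c
  h_jacobi : ∀ a b c, T.h a b c = T.h c b a - T.h c a b

/-- The cyclic identity becomes a rewriting rule: combined with anticommutativity in `b`, `c`, it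
moves the last argument to the front of both resulting terms. -/
theorem TernaryOps.IsSymmetric.of_mod_bot {T : TernaryOps F V} (hT : T.SymmetriesMod ⊥) :
    T.IsSymmetric where
  f_swap₁₂ a b c := sub_eq_zero.1 ((Submodule.mem_bot F).1 (hT.f_swap₁₂ a b c))
  f_swap₂₃ a b c := sub_eq_zero.1 ((Submodule.mem_bot F).1 (hT.f_swap₂₃ a b c))
  g_swap a b c := eq_neg_of_add_eq_zero_left ((Submodule.mem_bot F).1 (hT.g_anticomm a b c))
  h_swap a b c := eq_neg_of_add_eq_zero_left ((Submodule.mem_bot F).1 (hT.h_anticomm a b c))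
  h_jacobi a b c := by
    have h1 := (Submodule.mem_bot F).1 (hT.h_jacobi a b c)
    have h2 := (Submodule.mem_bot F).1 (hT.h_anticomm b c a)
    linear_combination (norm := module) h1 - h2

theorem TernaryOps.IsSymmetric.symmetriesMod {T : TernaryOps F V} (hT : T.IsSymmetric)
    (I : Submodule F V) : T.SymmetriesMod I where
  f_swap₁₂ a b c := by rw [hT.f_swap₁₂ a b c, sub_self]; exact I.zero_mem
  f_swap₂₃ a b c := by rw [hT.f_swap₂₃ a b c, sub_self]; exact I.zero_mem
  g_anticomm a b c := by rw [hT.g_swap a b c, neg_add_cancel]; exact I.zero_mem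
  h_anticomm a b c := by rw [hT.h_swap a b c, neg_add_cancel]; exact I.zero_mem
  h_jacobi a b c := by
    convert I.zero_mem
    linear_combination (norm := module) hT.h_jacobi a b c + hT.h_swap b c a

theorem TernaryOps.IsPoissonTripleSystem.isSymmetric {T : TernaryOps F V}
    (hT : T.IsPoissonTripleSystem) : T.IsSymmetric :=
  .of_mod_bot
    { f_swap₁₂ := fun a b c => by simpa [sub_eq_zero] using hT.f_swap₁₂ a b c
      f_swap₂₃ := fun a b c => by simpa [sub_eq_zero] using hT.f_swap₂₃ a b c
      g_anticomm := fun a b c => by simpa using hT.g_anticomm a b c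
      h_anticomm := fun a b c => by simpa using hT.h_anticomm a b c
      h_jacobi := fun a b c => by simpa using hT.h_jacobi a b c }

theorem TernaryOps.SymmetriesMod.isSymmetric_quotient {T : TernaryOps F V} {I : Submodule F V}
    (hT : T.SymmetriesMod I) (hI : T.IsIdeal I) : (T.quotient I).IsSymmetric := by
  have h0 : ∀ a, I.mkQ a = 0 ↔ a ∈ I := fun a => by
    rw [← LinearMap.mem_ker, Submodule.ker_mkQ]
  refine .of_mod_bot ⟨?_, ?_, ?_, ?_, ?_⟩ <;> intro a b c <;>
    obtain ⟨a, rfl⟩ := I.mkQ_surjective a <;>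
    obtain ⟨b, rfl⟩ := I.mkQ_surjective b <;>
    obtain ⟨c, rfl⟩ := I.mkQ_surjective c <;>
    simp only [← hI.isHom_mkQ.map_f, ← hI.isHom_mkQ.map_g, ← hI.isHom_mkQ.map_h, ← map_sub,
      ← map_add, Submodule.mem_bot, h0]
  · exact hT.f_swap₁₂ a b c
  · exact hT.f_swap₂₃ a b c
  · exact hT.g_anticomm a b c
  · exact hT.h_anticomm a b c
  · exact hT.h_jacobi a b c

end Symmetric

/-! ### Evaluation homomorphisms and universal properties of the free algebras -/

section Evaluation

variable {F : Type u} [Field F] {V : Type v} [AddCommGroup V] [Module F V] {X : Type w}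

/-- The value of a binary monomial at a tuple of elements of a space with two operations. -/
def BinaryMonomial.eval (P : BinaryOps F V) (x : X → V) : BinaryMonomial X → V
  | var i => x i
  | mul r s => P.mul (r.eval P x) (s.eval P x)
  | bracket r s => P.bracket (r.eval P x) (s.eval P x)

theorem TernaryMonomial.eval_expand (P : BinaryOps F V) (x : X → V) (m : TernaryMonomial X) :
    m.expand.eval P x = m.eval P.toTernary x := by
  induction m <;>
    simp_all [expand, eval, BinaryMonomial.eval, BinaryOps.toTernary_f, BinaryOps.toTernary_g,
      BinaryOps.toTernary_h]

theorem TernaryMonomial.eval_rename {Y : Type*} (T : TernaryOps F V) (x : Y → V) (σ : X → Y)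
    (m : TernaryMonomial X) : (m.rename σ).eval T x = m.eval T (x ∘ σ) := by
  induction m <;> simp_all [rename, eval]

theorem TernaryOps.IsHom.map_relation {W : Type*} [AddCommGroup W] [Module F W]
    {T : TernaryOps F V} {T' : TernaryOps F W} {φ : V →ₗ[F] W} (hφ : T.IsHom T' φ) (i : Fin 9)
    (a b c d e : V) :
    φ (T.relation i a b c d e) = T'.relation i (φ a) (φ b) (φ c) (φ d) (φ e) := by
  fin_cases i <;>
    simp only [TernaryOps.relation, map_sub, map_add, hφ.map_f, hφ.map_g, hφ.map_h]

/-- Evaluation at a tuple, as a linear map on polynomials. -/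
noncomputable abbrev TernaryOps.evalPoly (T : TernaryOps F V) (x : X → V) :
    (TernaryMonomial X →₀ F) →ₗ[F] V :=
  Finsupp.linearCombination F (TernaryMonomial.eval T x)

/-- Evaluation at a tuple, as a linear map on polynomials. -/
noncomputable abbrev BinaryOps.evalPoly (P : BinaryOps F V) (x : X → V) :
    (BinaryMonomial X →₀ F) →ₗ[F] V :=
  Finsupp.linearCombination F (BinaryMonomial.eval P x)

theorem TernaryOps.isHom_evalPoly (T : TernaryOps F V) (x : X → V) :
    (freeTernaryOps F X).IsHom T (T.evalPoly x) where
  map_f := trilinear_ext F _ _ _ (by intro r s t; simp [TernaryMonomial.eval])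
  map_g := trilinear_ext F _ _ _ (by intro r s t; simp [TernaryMonomial.eval])
  map_h := trilinear_ext F _ _ _ (by intro r s t; simp [TernaryMonomial.eval])

theorem bilinear_ext {α : Type*} (op : α → α → α) (φ : (α →₀ F) →ₗ[F] V) (B : V →ₗ[F] V →ₗ[F] V)
    (H : ∀ r s, φ (.single (op r s) 1) = B (φ (.single r 1)) (φ (.single s 1)))
    (a b : α →₀ F) : φ (bilinearExt F op a b) = B (φ a) (φ b) := by
  have : (bilinearExt F op).compr₂ φ = B.compl₁₂ φ φ := by
    ext r s
    simp [bilinearExt, H]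
  exact LinearMap.congr_fun₂ this a b

theorem BinaryOps.evalPoly_mul (P : BinaryOps F V) (x : X → V) (a b : BinaryMonomial X →₀ F) :
    P.evalPoly x ((freeBinaryOps F X).mul a b) = P.mul (P.evalPoly x a) (P.evalPoly x b) :=
  bilinear_ext _ _ _ (by intro r s; simp [BinaryMonomial.eval]) a b

theorem BinaryOps.evalPoly_bracket (P : BinaryOps F V) (x : X → V)
    (a b : BinaryMonomial X →₀ F) :
    P.evalPoly x ((freeBinaryOps F X).bracket a b)
      = P.bracket (P.evalPoly x a) (P.evalPoly x b) :=
  bilinear_ext _ _ _ (by intro r s; simp [BinaryMonomial.eval]) a b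

theorem TernaryOps.isIdeal_bot (T : TernaryOps F V) : T.IsIdeal ⊥ where
  f_mem a b c h := by
    simp only [Submodule.mem_bot] at *; rcases h with rfl | rfl | rfl <;> simp
  g_mem a b c h := by
    simp only [Submodule.mem_bot] at *; rcases h with rfl | rfl | rfl <;> simp
  h_mem a b c h := by
    simp only [Submodule.mem_bot] at *; rcases h with rfl | rfl | rfl <;> simp

/-- The kernel of evaluation, which is the preimage of the zero ideal, is itself an ideal modulo
which the symmetries hold, hence contains the least one. -/
theorem symmetryIdeal_le_ker_evalPoly {T : TernaryOps F V} (hT : T.IsSymmetric) (x : X → V) :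
    symmetryIdeal F X ≤ LinearMap.ker (T.evalPoly x) :=
  sInf_le ⟨(T.isHom_evalPoly x).isIdeal_comap T.isIdeal_bot,
    (T.isHom_evalPoly x).symmetriesMod_comap (hT.symmetriesMod ⊥)⟩

theorem poissonIdeal_le_ker_evalPoly (P : PoissonAlgebra F V) (x : X → V) :
    poissonIdeal F X ≤ LinearMap.ker (P.evalPoly x) := by
  refine sInf_le ⟨⟨?_, ?_⟩, ⟨?_, ?_, ?_, ?_, ?_⟩⟩ <;>
    simp only [LinearMap.mem_ker, BinaryOps.evalPoly_mul, BinaryOps.evalPoly_bracket, map_sub,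
      map_add]
  · rintro a b (h | h) <;> simp [h]
  · rintro a b (h | h) <;> simp [h]
  · intro a b; rw [P.mul_comm, sub_self]
  · intro a b; exact P.bracket_anticomm _ _
  · intro a b c; rw [P.mul_assoc, sub_self]
  · intro a b c; exact P.jacobi _ _ _
  · intro a b c; rw [P.leibniz, sub_self]

/-- The homomorphism from the free algebra with symmetries defined by a tuple of elements. -/
noncomputable def TernaryOps.IsSymmetric.lift {T : TernaryOps F V} (hT : T.IsSymmetric)
    (x : X → V) : FreeTernary F X →ₗ[F] V :=
  (symmetryIdeal F X).liftQ (T.evalPoly x) (symmetryIdeal_le_ker_evalPoly hT x)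

theorem TernaryOps.IsSymmetric.lift_mkQ {T : TernaryOps F V} (hT : T.IsSymmetric) (x : X → V)
    (p : TernaryMonomial X →₀ F) :
    hT.lift x ((symmetryIdeal F X).mkQ p) = T.evalPoly x p := rfl

theorem TernaryOps.IsSymmetric.lift_ternaryClass {T : TernaryOps F V} (hT : T.IsSymmetric)
    (x : X → V) (m : TernaryMonomial X) : hT.lift x (ternaryClass F m) = m.eval T x := by
  rw [ternaryClass, hT.lift_mkQ, Finsupp.linearCombination_single, one_smul]

/-- The homomorphism from the free Poisson algebra defined by a tuple of elements. -/
noncomputable def PoissonAlgebra.lift (P : PoissonAlgebra F V) (x : X → V) :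
    FreePoisson F X →ₗ[F] V :=
  (poissonIdeal F X).liftQ (P.evalPoly x) (poissonIdeal_le_ker_evalPoly P x)

theorem PoissonAlgebra.lift_mkQ (P : PoissonAlgebra F V) (x : X → V) (p : BinaryMonomial X →₀ F) :
    P.lift x ((poissonIdeal F X).mkQ p) = P.evalPoly x p := rfl

theorem PoissonAlgebra.lift_poissonClass (P : PoissonAlgebra F V) (x : X → V)
    (m : BinaryMonomial X) : P.lift x (poissonClass F m) = m.eval P.toBinaryOps x := by
  rw [poissonClass, P.lift_mkQ, Finsupp.linearCombination_single, one_smul]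

variable (F X)

/-- The operations of the free algebra with symmetries. -/
noncomputable abbrev symmetricOps : TernaryOps F (FreeTernary F X) :=
  (freeTernaryOps F X).quotient (symmetryIdeal F X)

theorem symmetricOps_isSymmetric : (symmetricOps F X).IsSymmetric :=
  (symmetryIdeal_symmetriesMod F X).isSymmetric_quotient (symmetryIdeal_isIdeal F X)

/-- The operations of the free Poisson algebra. -/
noncomputable def freePoisson : PoissonAlgebra F (FreePoisson F X) :=
  .ofQuotient (poissonIdeal_isIdeal F X) (poissonIdeal_poissonMod F X)

variable {X}

/-- This turns questions on classes of monomials into questions on values at a tuple in an algebra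
satisfying the symmetries, where the reductions below are carried out. -/
theorem ternaryClass_eq_eval (m : TernaryMonomial X) :
    ternaryClass F m = m.eval (symmetricOps F X) fun i => ternaryClass F (.var i) := by
  have h := (symmetryIdeal_isIdeal F X).isHom_mkQ
  induction m with
  | var x => rfl
  | f r s t hr hs ht =>
    simp only [TernaryMonomial.eval]
    rw [← hr, ← hs, ← ht]
    simp only [ternaryClass, ← h.map_f, freeTernaryOps, trilinearExt_single, mul_one]
  | g r s t hr hs ht =>
    simp only [TernaryMonomial.eval]
    rw [← hr, ← hs, ← ht]
    simp only [ternaryClass, ← h.map_g, freeTernaryOps, trilinearExt_single, mul_one]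
  | h r s t hr hs ht =>
    simp only [TernaryMonomial.eval]
    rw [← hr, ← hs, ← ht]
    simp only [ternaryClass, ← h.map_h, freeTernaryOps, trilinearExt_single, mul_one]

theorem poissonClass_eq_eval (m : BinaryMonomial X) :
    poissonClass F m = m.eval (freePoisson F X).toBinaryOps fun i => poissonClass F (.var i) := by
  have h1 := fun a b => quotientBilinear_mkQ (poissonIdeal_isIdeal F X).mul_mem a b
  have h2 := fun a b => quotientBilinear_mkQ (poissonIdeal_isIdeal F X).bracket_mem a b
  induction m with
  | var x => rfl
  | mul r s hr hs =>
    simp only [BinaryMonomial.eval]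
    rw [← hr, ← hs]
    refine Eq.trans ?_ (h1 _ _).symm
    simp only [poissonClass, freeBinaryOps, bilinearExt_single, mul_one]
  | bracket r s hr hs =>
    simp only [BinaryMonomial.eval]
    rw [← hr, ← hs]
    refine Eq.trans ?_ (h2 _ _).symm
    simp only [poissonClass, freeBinaryOps, bilinearExt_single, mul_one]

end Evaluation

/-! ### The nine relations hold in Poisson algebras -/

section Satisfied

variable {F : Type u} [Field F] {V : Type v} [AddCommGroup V] [Module F V]

theorem PoissonAlgebra.mul_left_comm (P : PoissonAlgebra F V) (a b c : V) :
    P.mul a (P.mul b c) = P.mul b (P.mul a c) := by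
  rw [← P.mul_assoc, P.mul_comm a b, P.mul_assoc]

theorem PoissonAlgebra.bracket_swap (P : PoissonAlgebra F V) (a b : V) :
    P.bracket a b = -P.bracket b a :=
  eq_neg_of_add_eq_zero_left (P.bracket_anticomm a b)

theorem PoissonAlgebra.bracket_mul_left (P : PoissonAlgebra F V) (a b c : V) :
    P.bracket (P.mul b c) a = P.mul (P.bracket b a) c + P.mul b (P.bracket c a) := by
  rw [P.bracket_swap, P.leibniz, P.bracket_swap a b, P.bracket_swap a c]
  simp only [map_neg, LinearMap.neg_apply]
  abel

theorem PoissonAlgebra.bracket_bracket_right (P : PoissonAlgebra F V) (a b c : V) :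
    P.bracket a (P.bracket b c) = P.bracket (P.bracket a b) c - P.bracket (P.bracket a c) b := by
  have h := P.jacobi a b c
  rw [P.bracket_swap (P.bracket b c) a, P.bracket_swap c a, map_neg, LinearMap.neg_apply] at h
  linear_combination (norm := module) -h

/-- Brackets of products are expanded by the Leibniz rule and nested brackets are made left-normed
by the Jacobi identity where needed; commutativity and associativity then make the two sides
comparable. -/
theorem PoissonAlgebra.relation_eq_zero (P : PoissonAlgebra F V) (i : Fin 9) (a b c d e : V) :
    P.toTernary.relation i a b c d e = 0 := by
  have hbr : ∀ x y, P.bracket (-x) y = -P.bracket x y := fun x y => by simp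
  have hl := P.bracket_mul_left
  have hr := P.bracket_bracket_right
  fin_cases i <;>
    simp only [TernaryOps.relation, BinaryOps.toTernary_f, BinaryOps.toTernary_g,
      BinaryOps.toTernary_h]
  · simp only [P.mul_assoc, sub_self]
  · simp only [P.mul_assoc, sub_self]
  · simp only [P.mul_comm, P.mul_left_comm, P.mul_assoc, sub_self]
  · rw [P.bracket_swap c e]
    simp only [hl, map_add, map_neg, LinearMap.add_apply, LinearMap.neg_apply]
    simp only [P.mul_comm, P.mul_left_comm]
    module
  · simp only [hl, map_add, LinearMap.add_apply]
    simp only [P.mul_comm, P.mul_left_comm, P.mul_assoc]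
    module
  · rw [P.bracket_swap d c, P.bracket_swap e c]
    simp only [hl, map_add, map_neg, LinearMap.add_apply, LinearMap.neg_apply]
    simp only [P.mul_comm]
    module
  -- The seventh relation is a Lie identity multiplied by `e`. It arises by expanding [[a,b],[c,d]]
  -- in two ways, letting c, d act on [a,b] or a, b act on [c,d]; `h2` then eliminates
  -- [[[a,b],d],c].
  · have h1 := hr (P.bracket a b) c d
    rw [P.bracket_swap (P.bracket a b), hr] at h1
    have h2 := congrArg (fun x => P.bracket x c) (hr a b d)
    simp only [P.bracket_swap a (P.bracket b d), hbr, map_sub, LinearMap.sub_apply] at h2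
    have h3 : P.bracket (P.bracket (P.bracket a b) c) d
        = P.bracket (P.bracket (P.bracket a d) b) c - P.bracket (P.bracket (P.bracket b d) a) c
          - P.bracket (P.bracket (P.bracket c d) a) b
          + P.bracket (P.bracket (P.bracket c d) b) a := by
      linear_combination (norm := module) -h1 - h2
    rw [h3]
    simp only [map_add, map_sub, LinearMap.add_apply, LinearMap.sub_apply]
    module
  · rw [P.bracket_swap c (P.bracket (P.bracket a b) d), 
      P.bracket_swap (P.bracket c d) (P.bracket (P.bracket a b) e)]
    simp only [hr, map_sub, map_neg, LinearMap.sub_apply, LinearMap.neg_apply]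
    module
  · rw [P.bracket_swap e a, P.bracket_swap e c]
    simp only [hl, map_add, map_neg, LinearMap.add_apply, LinearMap.neg_apply]
    simp only [P.mul_comm, P.mul_left_comm, P.mul_assoc]
    module

end Satisfied

/-! ### Normal forms in Poisson algebras: products of left-normed Lie monomials -/

section Spanning

variable {F : Type u} [Field F] {V : Type v} [AddCommGroup V] [Module F V] {X : Type w}

/-- The left-normed Lie monomial `[[[x a, x b], x c], …]` of a list of variables. -/
def PoissonAlgebra.lie (P : PoissonAlgebra F V) (x : X → V) : List X → V
  | [] => 0
  | a :: t => t.foldl (fun s y => P.bracket s (x y)) (x a)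

/-- The right-normed product of a nonempty list. -/
def PoissonAlgebra.mulList (P : PoissonAlgebra F V) : List V → V
  | [] => 0
  | [a] => a
  | a :: b :: l => P.mul a (P.mulList (b :: l))

theorem PoissonAlgebra.lie_concat (P : PoissonAlgebra F V) (x : X → V) {w : List X} (hw : w ≠ [])
    (y : X) : P.lie x (w ++ [y]) = P.bracket (P.lie x w) (x y) := by
  cases w with
  | nil => exact absurd rfl hw
  | cons a t => simp [lie, List.foldl_append]

theorem PoissonAlgebra.mulList_cons (P : PoissonAlgebra F V) (a : V) {l : List V} (hl : l ≠ []) :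
    P.mulList (a :: l) = P.mul a (P.mulList l) := by
  cases l with
  | nil => exact absurd rfl hl
  | cons b l => rfl

theorem PoissonAlgebra.mulList_append (P : PoissonAlgebra F V) {l l' : List V} (hl : l ≠ [])
    (hl' : l' ≠ []) : P.mulList (l ++ l') = P.mul (P.mulList l) (P.mulList l') := by
  induction l with
  | nil => exact absurd rfl hl
  | cons a l ih =>
    rcases eq_or_ne l [] with rfl | h
    · exact P.mulList_cons a hl'
    · rw [List.cons_append, P.mulList_cons _ (by simp [h]), ih h, P.mulList_cons _ h, P.mul_assoc]

theorem PoissonAlgebra.mulList_perm (P : PoissonAlgebra F V) {l l' : List V} (h : l.Perm l') :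
    P.mulList l = P.mulList l' := by
  induction h with
  | nil => rfl
  | @cons a l l' h ih =>
    rcases eq_or_ne l [] with rfl | h'
    · rw [List.nil_perm.1 h]
    · rw [P.mulList_cons _ h', ih, P.mulList_cons]
      rintro rfl
      exact h' (List.perm_nil.1 h)
  | swap a b l =>
    rcases eq_or_ne l [] with rfl | h
    · exact P.mul_comm _ _
    · rw [P.mulList_cons _ (by simp), P.mulList_cons _ h, P.mulList_cons _ (by simp),
        P.mulList_cons _ h, P.mul_left_comm]
  | trans _ _ ih₁ ih₂ => exact ih₁.trans ih₂

/-- The span of the left-normed Lie monomials starting with `a`,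
the other arguments being given up to order. -/
def PoissonAlgebra.lieSpan (P : PoissonAlgebra F V) (x : X → V) (a : X) (l : List X) :
    Submodule F V :=
  Submodule.span F {z | ∃ t : List X, t.Perm l ∧ z = P.lie x (a :: t)}

theorem PoissonAlgebra.lieSpan_perm (P : PoissonAlgebra F V) (x : X → V) (a : X) {l l' : List X}
    (h : l.Perm l') : P.lieSpan x a l = P.lieSpan x a l' := by
  have : ∀ t : List X, t.Perm l ↔ t.Perm l' := fun t => ⟨fun ht => ht.trans h, (·.trans h.symm)⟩
  simp only [lieSpan, this]

theorem PoissonAlgebra.bracket_mem_lieSpan (P : PoissonAlgebra F V) (x : X → V) {a : X}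
    {l : List X} {z : V} (hz : z ∈ P.lieSpan x a l) (y : X) :
    P.bracket z (x y) ∈ P.lieSpan x a (l ++ [y]) := by
  suffices h : P.lieSpan x a l ≤ (P.lieSpan x a (l ++ [y])).comap (P.bracket.flip (x y)) from h hz
  refine Submodule.span_le.2 ?_
  rintro _ ⟨t, ht, rfl⟩
  exact Submodule.subset_span
    ⟨t ++ [y], ht.append_right _, (P.lie_concat x (List.cons_ne_nil a t) y).symm⟩

/-- Induction on the last letter of `v`: [u,[v,y]] = [[u,v],y] - [[u,y],v]. The right factor becomes
shorter in both terms, and the first letter `a` stays in front. -/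
theorem PoissonAlgebra.bracket_lie_lie_mem (P : PoissonAlgebra F V) (x : X → V) (a : X)
    (u : List X) {v : List X} (hv : v ≠ []) :
    P.bracket (P.lie x (a :: u)) (P.lie x v) ∈ P.lieSpan x a (u ++ v) := by
  induction v using List.reverseRecOn generalizing u with
  | nil => exact absurd rfl hv
  | append_singleton v y ih =>
    rcases eq_or_ne v [] with rfl | h
    · refine Submodule.subset_span ⟨u ++ [y], .refl _, ?_⟩
      rw [← List.cons_append, P.lie_concat x (List.cons_ne_nil a u)]
      rfl
    · rw [P.lie_concat x h, P.bracket_bracket_right, ← P.lie_concat x (List.cons_ne_nil a u)]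
      refine Submodule.sub_mem _ ?_ ?_
      · rw [← List.append_assoc]
        exact P.bracket_mem_lieSpan x (ih u h) y
      · have h' := ih (u ++ [y]) h
        rwa [P.lieSpan_perm x a (l' := u ++ (v ++ [y]))] at h'
        rw [List.append_assoc]
        exact List.perm_append_comm.append_left u

/-- Any letter can be brought to the front. If `a` is the last letter, then [w,a] = -[a,w] and the
preceding lemma applies with left factor `a` alone; otherwise `a` is moved to the front inside the
shorter word. -/
theorem PoissonAlgebra.lie_mem_lieSpan (P : PoissonAlgebra F V) (x : X → V) {a : X}
    {w l : List X} (h : w.Perm (a :: l)) : P.lie x w ∈ P.lieSpan x a l := by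
  classical
  induction w using List.reverseRecOn generalizing l with
  | nil => exact absurd h.length_eq (by simp)
  | append_singleton w y ih =>
    by_cases hy : y = a
    · subst hy
      have hw : w.Perm l :=
        (List.perm_cons y).1 ((List.perm_append_comm (l₁ := [y])).trans h)
      rw [← P.lieSpan_perm x y hw]
      rcases eq_or_ne w [] with rfl | h'
      · exact Submodule.subset_span ⟨[], .refl _, rfl⟩
      · rw [P.lie_concat x h', P.bracket_swap]
        exact Submodule.neg_mem _ (P.bracket_lie_lie_mem x y [] h')
    · have ha : a ∈ w := by
        have := h.mem_iff.2 (List.mem_cons_self (a := a))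
        simpa [Ne.symm hy] using this
      have hw := List.perm_cons_erase ha
      rw [P.lie_concat x (List.ne_nil_of_mem ha), P.lieSpan_perm x a (l' := w.erase a ++ [y])]
      · exact P.bracket_mem_lieSpan x (ih hw) y
      · exact (List.perm_cons a).1 (h.symm.trans (hw.append_right [y]))

/-- A nonempty list starts with a smallest element. -/
def MinHead [LinearOrder X] (w : List X) : Prop :=
  ∃ a t, w = a :: t ∧ ∀ y ∈ t, a ≤ y

/-- The span of the products of left-normed Lie monomials, each starting with a smallest variable,
with given arguments up to order. -/
def PoissonAlgebra.normalSpan [LinearOrder X] (P : PoissonAlgebra F V) (x : X → V) (l : List X) :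
    Submodule F V :=
  Submodule.span F {z | ∃ ws : List (List X), ws ≠ [] ∧ (∀ w ∈ ws, MinHead w) ∧
    ws.flatten.Perm l ∧ z = P.mulList (ws.map (P.lie x))}

theorem PoissonAlgebra.normalSpan_perm [LinearOrder X] (P : PoissonAlgebra F V) (x : X → V)
    {l l' : List X} (h : l.Perm l') : P.normalSpan x l = P.normalSpan x l' := by
  have : ∀ t : List X, t.Perm l ↔ t.Perm l' := fun t => ⟨fun ht => ht.trans h, (·.trans h.symm)⟩
  simp only [normalSpan, this]

theorem PoissonAlgebra.lieSpan_le_normalSpan [LinearOrder X] (P : PoissonAlgebra F V) (x : X → V)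
    {a : X} {l : List X} (h : ∀ y ∈ l, a ≤ y) : P.lieSpan x a l ≤ P.normalSpan x (a :: l) := by
  refine Submodule.span_le.2 ?_
  rintro _ ⟨t, ht, rfl⟩
  refine Submodule.subset_span ⟨[a :: t], by simp, ?_, by simpa using ht, rfl⟩
  intro w hw
  rw [List.mem_singleton.1 hw]
  exact ⟨a, t, rfl, fun y hy => h y (ht.mem_iff.1 hy)⟩

theorem PoissonAlgebra.lie_mem_normalSpan [LinearOrder X] (P : PoissonAlgebra F V) (x : X → V)
    {w : List X} (hw : w ≠ []) : P.lie x w ∈ P.normalSpan x w := by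
  obtain ⟨b, t, rfl⟩ := List.exists_cons_of_ne_nil hw
  obtain ⟨a, ha, hmin⟩ := (b :: t).toFinset.exists_min_image id ⟨b, by simp⟩
  have hp := List.perm_cons_erase (List.mem_toFinset.1 ha)
  rw [P.normalSpan_perm x hp]
  refine P.lieSpan_le_normalSpan x (fun y hy => ?_) (P.lie_mem_lieSpan x hp)
  exact hmin y (List.mem_toFinset.2 (List.mem_of_mem_erase hy))

theorem PoissonAlgebra.bracket_lie_lie_mem_normalSpan [LinearOrder X] (P : PoissonAlgebra F V)
    (x : X → V) {u v : List X} (hu : u ≠ []) (hv : v ≠ []) :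
    P.bracket (P.lie x u) (P.lie x v) ∈ P.normalSpan x (u ++ v) := by
  obtain ⟨a, u, rfl⟩ := List.exists_cons_of_ne_nil hu
  have h : P.lieSpan x a (u ++ v) ≤ P.normalSpan x (a :: u ++ v) := by
    refine Submodule.span_le.2 ?_
    rintro _ ⟨t, ht, rfl⟩
    have := P.lie_mem_normalSpan x (List.cons_ne_nil a t)
    rwa [P.normalSpan_perm x (ht.cons a)] at this
  exact h (P.bracket_lie_lie_mem x a u hv)

theorem PoissonAlgebra.mul_mem_normalSpan [LinearOrder X] (P : PoissonAlgebra F V) (x : X → V)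
    {l l' : List X} {y z : V} (hy : y ∈ P.normalSpan x l) (hz : z ∈ P.normalSpan x l') :
    P.mul y z ∈ P.normalSpan x (l ++ l') := by
  have h := Submodule.apply_mem_map₂ P.mul hy hz
  rw [normalSpan, normalSpan, Submodule.map₂_span_span] at h
  refine Submodule.span_mono ?_ h
  rintro _ ⟨_, ⟨ws, h1, h2, h3, rfl⟩, _, ⟨vs, k1, k2, k3, rfl⟩, rfl⟩
  refine ⟨ws ++ vs, by simp [h1], ?_, ?_, ?_⟩
  · intro w hw
    exact (List.mem_append.1 hw).elim (h2 w) (k2 w)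
  · rw [List.flatten_append]
    exact h3.append k3
  · rw [List.map_append, P.mulList_append (by simpa using h1) (by simpa using k1)]

theorem PoissonAlgebra.mulList_mem_normalSpan [LinearOrder X] (P : PoissonAlgebra F V) (x : X → V)
    {ws : List (List X)} (h : ws ≠ []) (h' : ∀ w ∈ ws, w ≠ []) :
    P.mulList (ws.map (P.lie x)) ∈ P.normalSpan x ws.flatten := by
  induction ws with
  | nil => exact absurd rfl h
  | cons w ws ih =>
    have hw := P.lie_mem_normalSpan x (h' w (by simp))
    rcases eq_or_ne ws [] with rfl | hws
    · simpa [mulList] using hw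
    · rw [List.map_cons, P.mulList_cons _ (by simpa using hws), List.flatten_cons]
      exact P.mul_mem_normalSpan x hw (ih hws fun v hv => h' v (List.mem_cons_of_mem _ hv))

/-- Induction on the number of factors on the right, with the Leibniz rule splitting off one factor
at a time; the left argument is handled in the same way afterwards. -/
theorem PoissonAlgebra.bracket_lie_mulList_mem [LinearOrder X] (P : PoissonAlgebra F V)
    (x : X → V) {u : List X} (hu : u ≠ []) {vs : List (List X)} (h : vs ≠ [])
    (h' : ∀ v ∈ vs, v ≠ []) :
    P.bracket (P.lie x u) (P.mulList (vs.map (P.lie x))) ∈ P.normalSpan x (u ++ vs.flatten) := by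
  induction vs with
  | nil => exact absurd rfl h
  | cons v vs ih =>
    have hv := h' v (by simp)
    have huv := P.bracket_lie_lie_mem_normalSpan x hu hv
    rcases eq_or_ne vs [] with rfl | hvs
    · simpa [mulList] using huv
    · have hvs' : ∀ v ∈ vs, v ≠ [] := fun v hv => h' v (List.mem_cons_of_mem _ hv)
      rw [List.map_cons, P.mulList_cons _ (by simpa using hvs), List.flatten_cons, P.leibniz,
        ← List.append_assoc]
      refine Submodule.add_mem _
        (P.mul_mem_normalSpan x huv (P.mulList_mem_normalSpan x hvs hvs')) ?_
      rw [P.normalSpan_perm x (l' := v ++ (u ++ vs.flatten))]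
      · exact P.mul_mem_normalSpan x (P.lie_mem_normalSpan x hv) (ih hvs hvs')
      · rw [← List.append_assoc]
        exact List.perm_append_comm.append_right _

theorem PoissonAlgebra.bracket_mulList_mulList_mem [LinearOrder X] (P : PoissonAlgebra F V)
    (x : X → V) {us vs : List (List X)} (hu : us ≠ []) (hu' : ∀ u ∈ us, u ≠ []) (hv : vs ≠ [])
    (hv' : ∀ v ∈ vs, v ≠ []) :
    P.bracket (P.mulList (us.map (P.lie x))) (P.mulList (vs.map (P.lie x)))
      ∈ P.normalSpan x (us.flatten ++ vs.flatten) := by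
  induction us with
  | nil => exact absurd rfl hu
  | cons u us ih =>
    have hu0 := hu' u (by simp)
    have huv := P.bracket_lie_mulList_mem x hu0 hv hv'
    rcases eq_or_ne us [] with rfl | hus
    · simpa [mulList] using huv
    · have hus' : ∀ v ∈ us, v ≠ [] := fun v hv => hu' v (List.mem_cons_of_mem _ hv)
      rw [List.map_cons, P.mulList_cons _ (by simpa using hus), List.flatten_cons,
        P.bracket_mul_left]
      refine Submodule.add_mem _ ?_ ?_
      · rw [P.normalSpan_perm x (l' := (u ++ vs.flatten) ++ us.flatten)]
        · exact P.mul_mem_normalSpan x huv (P.mulList_mem_normalSpan x hus hus')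
        · rw [List.append_assoc, List.append_assoc]
          exact List.perm_append_comm.append_left _
      · rw [List.append_assoc]
        exact P.mul_mem_normalSpan x (P.lie_mem_normalSpan x hu0) (ih hus hus')

theorem MinHead.ne_nil [LinearOrder X] {w : List X} (hw : MinHead w) : w ≠ [] := by
  obtain ⟨a, t, rfl, _⟩ := hw
  exact List.cons_ne_nil a t

theorem PoissonAlgebra.bracket_mem_normalSpan [LinearOrder X] (P : PoissonAlgebra F V) (x : X → V)
    {l l' : List X} {y z : V} (hy : y ∈ P.normalSpan x l) (hz : z ∈ P.normalSpan x l') :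
    P.bracket y z ∈ P.normalSpan x (l ++ l') := by
  have h := Submodule.apply_mem_map₂ P.bracket hy hz
  rw [normalSpan, normalSpan, Submodule.map₂_span_span] at h
  refine Submodule.span_le.2 ?_ h
  rintro _ ⟨_, ⟨ws, h1, h2, h3, rfl⟩, _, ⟨vs, k1, k2, k3, rfl⟩, rfl⟩
  rw [SetLike.mem_coe, ← P.normalSpan_perm x (h3.append k3)]
  exact P.bracket_mulList_mulList_mem x h1 (fun w hw => (h2 w hw).ne_nil) k1
    fun w hw => (k2 w hw).ne_nil

/-- The normal span is closed under both operations, with concatenation of the argument lists, so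
induction on the monomial suffices. -/
theorem PoissonAlgebra.eval_mem_normalSpan [LinearOrder X] (P : PoissonAlgebra F V) (x : X → V)
    (m : BinaryMonomial X) : m.eval P.toBinaryOps x ∈ P.normalSpan x m.args := by
  induction m with
  | var i => exact P.lie_mem_normalSpan x (List.cons_ne_nil i [])
  | mul r s hr hs => exact P.mul_mem_normalSpan x hr hs
  | bracket r s hr hs => exact P.bracket_mem_normalSpan x hr hs

end Spanning

/-! ### A Poisson algebra of polynomials in words -/

section Model

variable (F : Type u) [Field F] (X : Type w)

/-- The bracket on the polynomial algebra in all words with `[X_u, X_v] = X_{uv} - X_{vu}`. -/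
noncomputable def wordDerivation :
    Derivation F (MvPolynomial (List X) F)
      (Derivation F (MvPolynomial (List X) F) (MvPolynomial (List X) F)) :=
  MvPolynomial.mkDerivation F fun u => MvPolynomial.mkDerivation F fun v =>
    MvPolynomial.X (u ++ v) - MvPolynomial.X (v ++ u)

/-- The bracket on the polynomial algebra in all words with `[X_u, X_v] = X_{uv} - X_{vu}`,
as a bilinear map. -/
noncomputable def wordBracket :
    MvPolynomial (List X) F →ₗ[F] MvPolynomial (List X) F →ₗ[F] MvPolynomial (List X) F :=
  LinearMap.mk₂ F (fun p q => wordDerivation F X p q) (by simp) (by simp) (by simp) (by simp)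

variable {X}

theorem wordBracket_X (u v : List X) :
    wordBracket F X (.X u) (.X v) = MvPolynomial.X (u ++ v) - MvPolynomial.X (v ++ u) := by
  simp [wordBracket, wordDerivation, MvPolynomial.mkDerivation_X]

theorem wordBracket_mul_left (p q r : MvPolynomial (List X) F) :
    wordBracket F X (p * q) r = p * wordBracket F X q r + q * wordBracket F X p r := by
  simp [wordBracket, Derivation.leibniz]

theorem wordBracket_mul_right (p q r : MvPolynomial (List X) F) :
    wordBracket F X r (p * q) = p * wordBracket F X r q + q * wordBracket F X r p := by
  simp [wordBracket, Derivation.leibniz]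

variable {F}

/-- Reduces an identity that is a derivation in one argument to the variables; anticommutativity and
the Jacobi identity are checked this way, one argument at a time. -/
theorem eq_zero_of_leibniz {σ : Type*} (D : MvPolynomial σ F →ₗ[F] MvPolynomial σ F)
    (h : ∀ p q, D (p * q) = p * D q + q * D p) (hX : ∀ i, D (.X i) = 0)
    (p : MvPolynomial σ F) : D p = 0 := by
  have : Derivation.mk' D h = 0 := MvPolynomial.derivation_ext fun i => hX i
  exact congrArg (fun D => D p) this

variable (F)

theorem wordBracket_anticomm (p q : MvPolynomial (List X) F) :
    wordBracket F X p q + wordBracket F X q p = 0 := by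
  refine eq_zero_of_leibniz (wordBracket F X p + (wordBracket F X).flip p) ?_ ?_ q
  · intro q r
    simp only [LinearMap.add_apply, LinearMap.flip_apply, wordBracket_mul_left,
      wordBracket_mul_right]
    ring
  intro u
  refine eq_zero_of_leibniz ((wordBracket F X).flip (.X u) + wordBracket F X (.X u)) ?_ ?_ p
  · intro q r
    simp only [LinearMap.add_apply, LinearMap.flip_apply, wordBracket_mul_left,
      wordBracket_mul_right]
    ring
  intro v
  simp [wordBracket_X]

/-- By the Leibniz rules and anticommutativity the Jacobi sum is a derivation in its last argument.
-/
theorem wordBracket_jacobi_of_X {p q : MvPolynomial (List X) F}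
    (h : ∀ u, wordBracket F X (wordBracket F X p q) (.X u)
      + wordBracket F X (wordBracket F X q (.X u)) p
      + wordBracket F X (wordBracket F X (.X u) p) q = 0) (r : MvPolynomial (List X) F) :
    wordBracket F X (wordBracket F X p q) r + wordBracket F X (wordBracket F X q r) p
      + wordBracket F X (wordBracket F X r p) q = 0 := by
  refine eq_zero_of_leibniz (wordBracket F X (wordBracket F X p q)
    + (wordBracket F X).flip p ∘ₗ wordBracket F X q
    + (wordBracket F X).flip q ∘ₗ (wordBracket F X).flip p) ?_ h r
  intro r s
  simp only [LinearMap.add_apply, LinearMap.comp_apply, LinearMap.flip_apply,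
    wordBracket_mul_left, wordBracket_mul_right, map_add]
  linear_combination wordBracket F X s p * wordBracket_anticomm F q r
    + wordBracket F X r p * wordBracket_anticomm F q s

theorem wordBracket_jacobi (p q r : MvPolynomial (List X) F) :
    wordBracket F X (wordBracket F X p q) r + wordBracket F X (wordBracket F X q r) p
      + wordBracket F X (wordBracket F X r p) q = 0 := by
  -- The Jacobi sum is cyclically invariant, so each argument can be rotated into last place and
  -- replaced by a variable. On variables the identity is the one for commutators in an associative
  -- algebra, here concatenation of words.
  refine wordBracket_jacobi_of_X F (fun u => ?_) r
  have h := wordBracket_jacobi_of_X F (p := .X u) (q := p) (fun v => ?_) q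
  · linear_combination h
  have h := wordBracket_jacobi_of_X F (p := .X v) (q := .X u) (fun w => ?_) p
  · linear_combination h
  simp only [wordBracket_X, map_sub, LinearMap.sub_apply, List.append_assoc]
  ring

variable (X) in
/-- The Poisson algebra of polynomials in words. -/
noncomputable def wordPoisson : PoissonAlgebra F (MvPolynomial (List X) F) where
  mul := LinearMap.mul F _
  bracket := wordBracket F X
  mul_comm := mul_comm
  bracket_anticomm := wordBracket_anticomm F
  mul_assoc := mul_assoc
  jacobi := wordBracket_jacobi F
  leibniz a b c := by
    rw [LinearMap.mul_apply', wordBracket_mul_right]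
    simp only [LinearMap.mul_apply']
    ring

variable (X) in
/-- The projection that annihilates the words not starting with a smallest variable. -/
noncomputable def minHeadProj [LinearOrder X] :
    MvPolynomial (List X) F →ₐ[F] MvPolynomial (List X) F :=
  open Classical in MvPolynomial.aeval fun w => if MinHead w then .X w else 0

/-- The span of the words containing `a` and starting with a larger letter. -/
noncomputable def remainder [LinearOrder X] (a : X) : Submodule F (MvPolynomial (List X) F) :=
  Submodule.span F {z | ∃ b v, a ∈ v ∧ a < b ∧ z = MvPolynomial.X (b :: v)}

/-- The leading word is the one in which every letter is appended on the right. Prepending a letter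
`y` buries `a` behind a larger head, and bracketing with further letters larger than `a` keeps such
words in the remainder. -/
theorem lie_wordPoisson [LinearOrder X] (a : X) (t : List X) (ha : ∀ y ∈ t, a < y) :
    (wordPoisson F X).lie (fun y => .X [y]) (a :: t) - .X (a :: t) ∈ remainder F a := by
  induction t using List.reverseRecOn with
  | nil => simp [PoissonAlgebra.lie]
  | append_singleton t y ih =>
    have hy : a < y := ha y (by simp)
    rw [← List.cons_append, (wordPoisson F X).lie_concat _ (List.cons_ne_nil a t)]
    have h : remainder F a ≤ (remainder F a).comap ((wordBracket F X).flip (.X [y])) := by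
      refine Submodule.span_le.2 ?_
      rintro _ ⟨b, v, h1, h2, rfl⟩
      rw [SetLike.mem_coe, Submodule.mem_comap, LinearMap.flip_apply, wordBracket_X]
      exact Submodule.sub_mem _ (Submodule.subset_span ⟨b, v ++ [y], by simp [h1], h2, rfl⟩)
        (Submodule.subset_span ⟨y, b :: v, by simp [h1], hy, rfl⟩)
    have h1 : wordBracket F X ((wordPoisson F X).lie (fun y => .X [y]) (a :: t) - .X (a :: t))
        (.X [y]) ∈ remainder F a := h (ih fun z hz => ha z (by simp [hz]))
    rw [map_sub, LinearMap.sub_apply, wordBracket_X] at h1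
    have h2 : MvPolynomial.X ([y] ++ a :: t) ∈ remainder F a :=
      Submodule.subset_span ⟨y, a :: t, by simp, hy, rfl⟩
    convert Submodule.sub_mem _ h1 h2 using 1
    change wordBracket F X _ _ - _ = _
    ring

/-- Every word of the remainder has a head larger than its letter `a` and is killed, so only the
leading word survives. -/
theorem minHeadProj_lie [LinearOrder X] {w : List X} (hw : MinHead w) (hn : w.Nodup) :
    minHeadProj F X ((wordPoisson F X).lie (fun y => .X [y]) w) = .X w := by
  obtain ⟨a, t, rfl, ht⟩ := hw
  have ha : a ∉ t := (List.nodup_cons.1 hn).1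
  have h1 := lie_wordPoisson F a t fun y hy =>
    lt_of_le_of_ne (ht y hy) fun h => ha (h ▸ hy)
  have h2 : remainder F a ≤ LinearMap.ker (minHeadProj F X).toLinearMap := by
    refine Submodule.span_le.2 ?_
    rintro _ ⟨b, v, hav, hab, rfl⟩
    have : ¬ MinHead (b :: v) := by
      rintro ⟨c, s, h, hc⟩
      obtain ⟨rfl, rfl⟩ := List.cons.inj h
      exact not_lt_of_ge (hc a hav) hab
    simp [minHeadProj, this]
  have h3 := h2 h1
  rw [LinearMap.mem_ker, map_sub, sub_eq_zero] at h3
  refine h3.trans ?_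
  have : MinHead (a :: t) := ⟨a, t, rfl, ht⟩
  simp [minHeadProj, this]

theorem minHeadProj_mulList [LinearOrder X] (l : List (List X)) (hl : l ≠ [])
    (h : ∀ w ∈ l, MinHead w ∧ w.Nodup) :
    minHeadProj F X ((wordPoisson F X).mulList (l.map
      ((wordPoisson F X).lie (fun y => .X [y])))) = (l.map MvPolynomial.X).prod := by
  induction l with
  | nil => exact absurd rfl hl
  | cons w l ih =>
    have hw := minHeadProj_lie F (h w (by simp)).1 (h w (by simp)).2
    rcases eq_or_ne l [] with rfl | h'
    · simpa [PoissonAlgebra.mulList] using hw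
    · rw [List.map_cons, (wordPoisson F X).mulList_cons _ (by simpa using h')]
      change minHeadProj F X (_ * _) = _
      rw [map_mul, hw, ih h' fun w hw => h w (List.mem_cons_of_mem _ hw), List.map_cons,
        List.prod_cons]

end Model

/-! ### Combinatorics of the Poisson table -/

section PoissonTable

/-- The blocks of arguments of the Lie factors of the monomials in the Poisson table. -/
def poissonBlocks (i : Fin 7) (σ : Fin 5 → Fin 5) : List (List (Fin 5)) :=
  match i with
  | 0 => [[σ 0, σ 1, σ 2, σ 3, σ 4]]
  | 1 => [[σ 0, σ 1, σ 2, σ 3], [σ 4]]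
  | 2 => [[σ 0, σ 1, σ 2], [σ 3, σ 4]]
  | 3 => [[σ 0, σ 1, σ 2], [σ 3], [σ 4]]
  | 4 => [[σ 0, σ 1], [σ 2, σ 3], [σ 4]]
  | 5 => [[σ 0, σ 1], [σ 2], [σ 3], [σ 4]]
  | 6 => [[σ 0], [σ 1], [σ 2], [σ 3], [σ 4]]

theorem flatten_poissonBlocks (i : Fin 7) (σ : Fin 5 → Fin 5) :
    (poissonBlocks i σ).flatten = [σ 0, σ 1, σ 2, σ 3, σ 4] := by
  fin_cases i <;> rfl

theorem map_length_poissonBlocks (i : Fin 7) (σ τ : Fin 5 → Fin 5) :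
    (poissonBlocks i σ).map List.length = (poissonBlocks i τ).map List.length := by
  fin_cases i <;> rfl

theorem poissonBlocks_ne_nil (i : Fin 7) (σ : Fin 5 → Fin 5) : poissonBlocks i σ ≠ [] := by
  fin_cases i <;> simp [poissonBlocks]

/-- The block lengths determine the association type, and the concatenation of the blocks determines
the permutation. -/
theorem poissonBlocks_injective {i j : Fin 7} {σ τ : Equiv.Perm (Fin 5)}
    (h : poissonBlocks i σ = poissonBlocks j τ) : i = j ∧ σ = τ := by
  constructor
  · have h' := congrArg (List.map List.length) h
    rw [map_length_poissonBlocks i σ id, map_length_poissonBlocks j τ id] at h'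
    clear h
    revert i j
    decide
  · have h' := congrArg List.flatten h
    simp only [flatten_poissonBlocks, List.cons.injEq] at h'
    ext k
    fin_cases k <;> simp [h']

theorem minHead_poissonBlocks (j : PoissonIndex) : ∀ w ∈ poissonBlocks j.1.1 j.1.2, MinHead w := by
  obtain ⟨⟨i, σ⟩, h⟩ := j
  fin_cases i <;> simp only [poissonOrder, Bool.and_eq_true, decide_eq_true_eq] at h <;>
    simp only [poissonBlocks, List.forall_mem_cons, MinHead, List.cons.injEq] <;>
    grind

theorem poissonType_eval {F : Type u} [Field F] {V : Type v} [AddCommGroup V] [Module F V]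
    (P : PoissonAlgebra F V) (x : Fin 5 → V) (i : Fin 7) (σ : Fin 5 → Fin 5) :
    ((poissonType i).rename σ).eval P.toBinaryOps x
      = P.mulList ((poissonBlocks i σ).map (P.lie x)) := by
  fin_cases i <;>
    simp [poissonType, poissonBlocks, BinaryMonomial.rename, BinaryMonomial.eval,
      PoissonAlgebra.mulList, PoissonAlgebra.lie, P.mul_assoc]

/-- Blocks are ordered by decreasing length, then lexicographically. -/
def BlockLE (u v : List (Fin 5)) : Prop :=
  v.length < u.length ∨ u.length = v.length ∧ u ≤ v

instance : Std.Total BlockLE := ⟨fun u v => by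
  have := le_total u v
  unfold BlockLE
  rcases lt_trichotomy u.length v.length with h | h | h
  · exact Or.inr (Or.inl h)
  · exact this.imp (fun h' => Or.inr ⟨h, h'⟩) fun h' => Or.inr ⟨h.symm, h'⟩
  · exact Or.inl (Or.inl h)⟩

instance : IsTrans (List (Fin 5)) BlockLE := ⟨fun u v w h h' => by
  rcases h with h | ⟨h, huv⟩ <;> rcases h' with h' | ⟨h', hvw⟩
  · exact Or.inl (h'.trans h)
  · exact Or.inl (h' ▸ h)
  · exact Or.inl (h ▸ h')
  · exact Or.inr ⟨h.trans h', huv.trans hvw⟩⟩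

instance : Std.Antisymm BlockLE := ⟨fun u v h h' => by
  rcases h with h | ⟨h, huv⟩ <;> rcases h' with h' | ⟨h', hvu⟩
  · omega
  · omega
  · omega
  · exact le_antisymm huv hvu⟩

theorem cons_le_cons_iff_of_ne {a b : Fin 5} (h : a ≠ b) (u v : List (Fin 5)) :
    a :: u ≤ b :: v ↔ a < b := by
  have key : ∀ {a b : Fin 5} (u v : List (Fin 5)), a < b → a :: u < b :: v :=
    fun _ _ h => List.cons_lt_cons_iff.2 (Or.inl h)
  refine ⟨fun h' => ?_, fun h' => (key u v h').le⟩
  by_contra hab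
  exact not_lt_of_ge h' (key v u (lt_of_le_of_ne (not_lt.1 hab) h.symm))

theorem pairwise_poissonBlocks (j : PoissonIndex) :
    (poissonBlocks j.1.1 j.1.2).Pairwise BlockLE := by
  obtain ⟨⟨i, σ⟩, h⟩ := j
  fin_cases i <;> simp only [poissonOrder, Bool.and_eq_true, decide_eq_true_eq] at h <;>
    simp [poissonBlocks, BlockLE, cons_le_cons_iff_of_ne] <;> grind

/-- The order conditions of the table say that the blocks are sorted for `BlockLE`, and a sorted
list is determined by its multiset. Thus commuting factors cannot identify two entries. -/
theorem poissonBlocks_perm_injective {j k : PoissonIndex}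
    (h : (poissonBlocks j.1.1 j.1.2).Perm (poissonBlocks k.1.1 k.1.2)) : j = k := by
  have h' := poissonBlocks_injective
    (h.eq_of_pairwise' (pairwise_poissonBlocks j) (pairwise_poissonBlocks k))
  exact Subtype.ext (Prod.ext h'.1 h'.2)

theorem exists_perm_of_nodup {a b c d e : Fin 5}
    (h : [a, b, c, d, e].Nodup) :
    ∃ σ : Equiv.Perm (Fin 5), σ 0 = a ∧ σ 1 = b ∧ σ 2 = c ∧ σ 3 = d ∧ σ 4 = e := by
  have hinj : Function.Injective ![a, b, c, d, e] := by
    rw [← List.nodup_ofFn]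
    simpa using h
  exact ⟨Equiv.ofBijective _ (Finite.injective_iff_bijective.1 hinj), rfl, rfl, rfl, rfl, rfl⟩

/-- The lengths of the sorted blocks form a partition of 5, and the seven partitions are the seven
association types. Minimal heads and sortedness give the order conditions. -/
theorem exists_poissonIndex {ws : List (List (Fin 5))} (h : ∀ w ∈ ws, MinHead w)
    (hn : ws.flatten.Nodup) (hl : ws.flatten.length = 5) (hs : ws.Pairwise BlockLE) :
    ∃ j : PoissonIndex, poissonBlocks j.1.1 j.1.2 = ws := by
  have key : ∀ (i : Fin 7) (x : Fin 5 → Fin 5), ws = poissonBlocks i x →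
      (∀ σ : Equiv.Perm (Fin 5), ⇑σ = x → poissonOrder i σ = true) →
      ∃ j : PoissonIndex, poissonBlocks j.1.1 j.1.2 = ws := by
    intro i x hx ho
    rw [hx, flatten_poissonBlocks] at hn
    obtain ⟨σ, h0, h1, h2, h3, h4⟩ := exists_perm_of_nodup hn
    have hσ : ⇑σ = x := by
      ext k
      fin_cases k <;> simp [*]
    exact ⟨⟨(i, σ), ho σ hσ⟩, by simp only [hσ, hx]⟩
  rcases ws with _ | ⟨w₁, _ | ⟨w₂, _ | ⟨w₃, _ | ⟨w₄, _ | ⟨w₅, _ | ⟨w₆, ws⟩⟩⟩⟩⟩⟩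
  · simp at hl
  · obtain ⟨a, t, rfl, h₁⟩ := h w₁ (by simp)
    have ht : t.length = 4 := by simpa using hl
    rcases t with _ | ⟨b, t⟩
    · simp at ht
    obtain ⟨c, d, e, rfl⟩ := List.length_eq_three.1 (Nat.succ.inj ht)
    refine key 0 ![a, b, c, d, e] rfl fun σ hσ => ?_
    simp [poissonOrder, hσ] at *
    grind
  · obtain ⟨a, t, rfl, h₁⟩ := h w₁ (by simp)
    obtain ⟨a', t', rfl, h₂⟩ := h w₂ (by simp)
    -- Tails are measured without their heads, so these are the partitions 4+1 and 3+2.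
    have ht : t.length = 3 ∧ t'.length = 0 ∨ t.length = 2 ∧ t'.length = 1 := by
      simp [BlockLE] at hl hs
      omega
    rcases ht with ⟨ht, ht'⟩ | ⟨ht, ht'⟩
    · obtain ⟨b, c, d, rfl⟩ := List.length_eq_three.1 ht
      obtain rfl := List.length_eq_zero_iff.1 ht'
      refine key 1 ![a, b, c, d, a'] rfl fun σ hσ => ?_
      simp [poissonOrder, hσ] at *
      grind
    · obtain ⟨b, c, rfl⟩ := List.length_eq_two.1 ht
      obtain ⟨e, rfl⟩ := List.length_eq_one_iff.1 ht'
      refine key 2 ![a, b, c, a', e] rfl fun σ hσ => ?_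
      simp [poissonOrder, hσ] at *
      grind
  · obtain ⟨a, t, rfl, h₁⟩ := h w₁ (by simp)
    obtain ⟨a', t', rfl, h₂⟩ := h w₂ (by simp)
    obtain ⟨e, u, rfl, h₃⟩ := h w₃ (by simp)
    have ht : t.length = 2 ∧ t'.length = 0 ∧ u.length = 0 ∨
        t.length = 1 ∧ t'.length = 1 ∧ u.length = 0 := by
      simp [BlockLE] at hl hs
      omega
    rcases ht with ⟨ht, ht', hu⟩ | ⟨ht, ht', hu⟩
    · obtain ⟨b, c, rfl⟩ := List.length_eq_two.1 ht
      obtain rfl := List.length_eq_zero_iff.1 ht'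
      obtain rfl := List.length_eq_zero_iff.1 hu
      have : a' ≠ e := by simp at hn; tauto
      refine key 3 ![a, b, c, a', e] rfl fun σ hσ => ?_
      simp [poissonOrder, BlockLE, cons_le_cons_iff_of_ne, *] at *
      grind
    · obtain ⟨b, rfl⟩ := List.length_eq_one_iff.1 ht
      obtain ⟨b', rfl⟩ := List.length_eq_one_iff.1 ht'
      obtain rfl := List.length_eq_zero_iff.1 hu
      have : a ≠ a' := by simp at hn; tauto
      refine key 4 ![a, b, a', b', e] rfl fun σ hσ => ?_
      simp [poissonOrder, BlockLE, cons_le_cons_iff_of_ne, *] at *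
      grind
  · obtain ⟨a, t, rfl, h₁⟩ := h w₁ (by simp)
    obtain ⟨c, t', rfl, h₂⟩ := h w₂ (by simp)
    obtain ⟨d, u, rfl, h₃⟩ := h w₃ (by simp)
    obtain ⟨e, u', rfl, h₄⟩ := h w₄ (by simp)
    have ht : t.length = 1 ∧ t'.length = 0 ∧ u.length = 0 ∧ u'.length = 0 := by
      simp [BlockLE] at hl hs
      omega
    obtain ⟨b, rfl⟩ := List.length_eq_one_iff.1 ht.1
    obtain rfl := List.length_eq_zero_iff.1 ht.2.1
    obtain rfl := List.length_eq_zero_iff.1 ht.2.2.1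
    obtain rfl := List.length_eq_zero_iff.1 ht.2.2.2
    have : c ≠ d ∧ d ≠ e ∧ c ≠ e := by simp at hn; tauto
    refine key 5 ![a, b, c, d, e] rfl fun σ hσ => ?_
    simp [poissonOrder, BlockLE, cons_le_cons_iff_of_ne, *] at *
    grind
  · obtain ⟨a, t, rfl, h₁⟩ := h w₁ (by simp)
    obtain ⟨b, t', rfl, h₂⟩ := h w₂ (by simp)
    obtain ⟨c, u, rfl, h₃⟩ := h w₃ (by simp)
    obtain ⟨d, u', rfl, h₄⟩ := h w₄ (by simp)
    obtain ⟨e, s, rfl, h₅⟩ := h w₅ (by simp)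
    have ht : t.length = 0 ∧ t'.length = 0 ∧ u.length = 0 ∧ u'.length = 0 ∧ s.length = 0 := by
      simp at hl
      omega
    obtain rfl := List.length_eq_zero_iff.1 ht.1
    obtain rfl := List.length_eq_zero_iff.1 ht.2.1
    obtain rfl := List.length_eq_zero_iff.1 ht.2.2.1
    obtain rfl := List.length_eq_zero_iff.1 ht.2.2.2.1
    obtain rfl := List.length_eq_zero_iff.1 ht.2.2.2.2
    have : a ≠ b ∧ b ≠ c ∧ c ≠ d ∧ d ≠ e := by simp at hn; tauto
    refine key 6 ![a, b, c, d, e] rfl fun σ hσ => ?_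
    simp [poissonOrder, BlockLE, cons_le_cons_iff_of_ne, *] at *
    grind
  · obtain ⟨_, _, rfl, _⟩ := h w₁ (by simp)
    obtain ⟨_, _, rfl, _⟩ := h w₂ (by simp)
    obtain ⟨_, _, rfl, _⟩ := h w₃ (by simp)
    obtain ⟨_, _, rfl, _⟩ := h w₄ (by simp)
    obtain ⟨_, _, rfl, _⟩ := h w₅ (by simp)
    obtain ⟨_, _, rfl, _⟩ := h w₆ (by simp)
    simp at hl
    omega

end PoissonTable

/-! ### The basis of P(5) -/

section PoissonBasis

variable (F : Type u) [Field F]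

theorem tableP_coe (j : PoissonIndex) :
    (tableP F j : FreePoisson F (Fin 5)) = (freePoisson F (Fin 5)).mulList
      ((poissonBlocks j.1.1 j.1.2).map
        ((freePoisson F (Fin 5)).lie fun i => poissonClass F (.var i))) := by
  rw [← poissonType_eval, ← poissonClass_eq_eval]
  rfl

theorem perm_finRange_of_isMultilinear {n : ℕ} {l : List (Fin n)} (h : ∀ i, l.count i = 1) :
    l.Perm (List.finRange n) := by
  rw [List.perm_iff_count]
  intro i
  rw [h, List.count_eq_one_of_mem (List.nodup_finRange n) (List.mem_finRange i)]

/-- A multilinear monomial is first rewritten as a combination of products of Lie monomials with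
least letters in front; sorting the commuting factors of each product then gives a table entry. -/
theorem multilinearP_le_span_tableP :
    multilinearP F 5 ≤ Submodule.span F (Set.range fun j => (tableP F j).1) := by
  refine Submodule.span_le.2 ?_
  rintro _ ⟨m, hm, rfl⟩
  have h := (freePoisson F (Fin 5)).eval_mem_normalSpan (fun i => poissonClass F (.var i)) m
  rw [← poissonClass_eq_eval, PoissonAlgebra.normalSpan_perm _ _
    (perm_finRange_of_isMultilinear hm)] at h
  refine Submodule.span_le.2 ?_ h
  rintro _ ⟨ws, _, h2, h3, rfl⟩
  classical
  have hp := List.perm_insertionSort BlockLE ws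
  have hf : (ws.insertionSort BlockLE).flatten.Perm (List.finRange 5) := hp.flatten.trans h3
  obtain ⟨j, hj⟩ := exists_poissonIndex (ws := ws.insertionSort BlockLE)
    (fun w hw => h2 w (hp.mem_iff.1 hw)) (hf.nodup_iff.2 (List.nodup_finRange 5))
    (by rw [hf.length_eq, List.length_finRange]) (List.pairwise_insertionSort BlockLE ws)
  refine Submodule.subset_span ⟨j, ?_⟩
  dsimp only
  rw [tableP_coe, hj]
  exact PoissonAlgebra.mulList_perm _ (hp.map _)

theorem span_tableP : Submodule.span F (Set.range (tableP F)) = ⊤ := by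
  refine Submodule.map_injective_of_injective (multilinearP F 5).injective_subtype ?_
  rw [Submodule.map_span, ← Set.range_comp, Submodule.map_top, Submodule.range_subtype]
  refine le_antisymm (Submodule.span_le.2 ?_) (multilinearP_le_span_tableP F)
  rintro _ ⟨j, rfl⟩
  exact (tableP F j).2

theorem lift_tableP {V : Type v} [AddCommGroup V] [Module F V] (P : PoissonAlgebra F V)
    (x : Fin 5 → V) (j : PoissonIndex) :
    P.lift x (tableP F j) = P.mulList ((poissonBlocks j.1.1 j.1.2).map (P.lie x)) := by
  rw [← poissonType_eval, ← P.lift_poissonClass]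
  rfl

theorem prod_map_X_eq_monomial {σ : Type*} [DecidableEq σ] (l : List σ) :
    (l.map MvPolynomial.X).prod
      = MvPolynomial.monomial (Multiset.toFinsupp (l : Multiset σ)) (1 : F) := by
  induction l with
  | nil => simp
  | cons w l ih =>
    rw [List.map_cons, List.prod_cons, ih, ← Multiset.cons_coe, ← Multiset.singleton_add,
      map_add, Multiset.toFinsupp_singleton, MvPolynomial.X, MvPolynomial.monomial_mul, one_mul]

theorem minHeadProj_lift_tableP (j : PoissonIndex) :
    minHeadProj F (Fin 5) ((wordPoisson F (Fin 5)).lift (fun y => .X [y]) (tableP F j))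
      = MvPolynomial.monomial
        (Multiset.toFinsupp (poissonBlocks j.1.1 j.1.2 : Multiset (List (Fin 5)))) 1 := by
  rw [lift_tableP, minHeadProj_mulList F _ (poissonBlocks_ne_nil _ _), prod_map_X_eq_monomial]
  intro w hw
  refine ⟨minHead_poissonBlocks j w hw, ?_⟩
  have h : (poissonBlocks j.1.1 j.1.2).flatten.Nodup := by
    rw [flatten_poissonBlocks]
    simp [j.1.2.injective.eq_iff]
  exact (List.nodup_flatten.1 h).1 w hw

/-- Evaluation in the word model followed by the projection sends the table to monomials of the
polynomial ring. These are distinct, since the multiset of blocks determines the entry. -/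
theorem linearIndependent_tableP : LinearIndependent F (tableP F) := by
  have h := (MvPolynomial.basisMonomials (List (Fin 5)) F).linearIndependent.comp
    (fun j : PoissonIndex =>
      Multiset.toFinsupp (poissonBlocks j.1.1 j.1.2 : Multiset (List (Fin 5))))
    fun j k h =>
      poissonBlocks_perm_injective (Multiset.coe_eq_coe.1 (Multiset.toFinsupp.injective h))
  rw [MvPolynomial.coe_basisMonomials] at h
  have hL := funext (minHeadProj_lift_tableP F)
  exact LinearIndependent.of_comp ((minHeadProj F (Fin 5)).toLinearMap ∘ₗ
    (wordPoisson F (Fin 5)).lift (fun y => .X [y]) ∘ₗ (multilinearP F 5).subtype)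
    (hL.symm ▸ h : LinearIndependent F fun j : PoissonIndex =>
      minHeadProj F (Fin 5) ((wordPoisson F (Fin 5)).lift (fun y => .X [y]) (tableP F j)))

/-- The basis of `P(5)` given by the table. -/
noncomputable def basisP : Module.Basis PoissonIndex F (multilinearP F 5) :=
  .mk (linearIndependent_tableP F) (span_tableP F).ge

theorem basisP_apply (j : PoissonIndex) : basisP F j = tableP F j :=
  Module.Basis.mk_apply _ _ j

end PoissonBasis

/-! ### Association types of ternary monomials of degree 5 -/

section Shapes

variable {X : Type w}

theorem TernaryMonomial.length_args_mod_two (m : TernaryMonomial X) : m.args.length % 2 = 1 := by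
  induction m with
  | var x => rfl
  | f r s t _ _ _ => simp only [args, List.length_append]; omega
  | g r s t _ _ _ => simp only [args, List.length_append]; omega
  | h r s t _ _ _ => simp only [args, List.length_append]; omega

theorem TernaryMonomial.exists_var_of_length {m : TernaryMonomial X} (h : m.args.length = 1) :
    ∃ x, m = .var x := by
  cases m with
  | var x => exact ⟨x, rfl⟩
  | f r s t => 
    have := r.length_args_mod_two; have := s.length_args_mod_two; have := t.length_args_mod_two
    simp only [args, List.length_append] at h; omega
  | g r s t =>
    have := r.length_args_mod_two; have := s.length_args_mod_two; have := t.length_args_mod_two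
    simp only [args, List.length_append] at h; omega
  | h r s t =>
    have := r.length_args_mod_two; have := s.length_args_mod_two; have := t.length_args_mod_two
    simp only [args, List.length_append] at h; omega

end Shapes

section Symmetric

variable {F : Type u} [Field F] {V : Type v} [AddCommGroup V] [Module F V]

/-- All monomials of degree 5 of the 12 association types with distinct arguments lie in `U`. -/
structure TernaryOps.TypesMem (T : TernaryOps F V) (U : Submodule F V) (x : Fin 5 → V) : Prop where
  ff : ∀ a b c d e, [a, b, c, d, e].Nodup → T.f (T.f (x a) (x b) (x c)) (x d) (x e) ∈ U
  fg : ∀ a b c d e, [a, b, c, d, e].Nodup → T.f (T.g (x a) (x b) (x c)) (x d) (x e) ∈ U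
  fh : ∀ a b c d e, [a, b, c, d, e].Nodup → T.f (T.h (x a) (x b) (x c)) (x d) (x e) ∈ U
  gf : ∀ a b c d e, [a, b, c, d, e].Nodup → T.g (T.f (x a) (x b) (x c)) (x d) (x e) ∈ U
  gf' : ∀ a b c d e, [a, b, c, d, e].Nodup → T.g (x a) (x b) (T.f (x c) (x d) (x e)) ∈ U
  gg : ∀ a b c d e, [a, b, c, d, e].Nodup → T.g (T.g (x a) (x b) (x c)) (x d) (x e) ∈ U
  gg' : ∀ a b c d e, [a, b, c, d, e].Nodup → T.g (x a) (x b) (T.g (x c) (x d) (x e)) ∈ U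
  gh : ∀ a b c d e, [a, b, c, d, e].Nodup → T.g (T.h (x a) (x b) (x c)) (x d) (x e) ∈ U
  gh' : ∀ a b c d e, [a, b, c, d, e].Nodup → T.g (x a) (x b) (T.h (x c) (x d) (x e)) ∈ U
  hf : ∀ a b c d e, [a, b, c, d, e].Nodup → T.h (T.f (x a) (x b) (x c)) (x d) (x e) ∈ U
  hg : ∀ a b c d e, [a, b, c, d, e].Nodup → T.h (T.g (x a) (x b) (x c)) (x d) (x e) ∈ U
  hh : ∀ a b c d e, [a, b, c, d, e].Nodup → T.h (T.h (x a) (x b) (x c)) (x d) (x e) ∈ U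

variable {T : TernaryOps F V} {U : Submodule F V} {x : Fin 5 → V}

/-- Monomials of degree 3 in three given variables. -/
inductive TernaryOps.IsCubic (T : TernaryOps F V) (a b c : V) : V → Prop
  | f : T.IsCubic a b c (T.f a b c)
  | g : T.IsCubic a b c (T.g a b c)
  | h : T.IsCubic a b c (T.h a b c)

theorem TernaryMonomial.isCubic_of_length (T : TernaryOps F V) (x : Fin 5 → V)
    {m : TernaryMonomial (Fin 5)} (h : m.args.length = 3) :
    ∃ a b c, m.args = [a, b, c] ∧ T.IsCubic (x a) (x b) (x c) (m.eval T x) := by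
  have key : ∀ r s t : TernaryMonomial (Fin 5), (r.args ++ s.args ++ t.args).length = 3 →
      ∃ a b c, r = .var a ∧ s = .var b ∧ t = .var c := by
    intro r s t h
    have := r.length_args_mod_two
    have := s.length_args_mod_two
    have := t.length_args_mod_two
    simp only [List.length_append] at h
    obtain ⟨a, rfl⟩ := r.exists_var_of_length (by omega)
    obtain ⟨b, rfl⟩ := s.exists_var_of_length (by omega)
    obtain ⟨c, rfl⟩ := t.exists_var_of_length (by omega)
    exact ⟨a, b, c, rfl, rfl, rfl⟩
  cases m with
  | var x => simp [args] at h
  | f r s t =>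
    obtain ⟨a, b, c, rfl, rfl, rfl⟩ := key r s t h
    exact ⟨a, b, c, rfl, .f⟩
  | g r s t =>
    obtain ⟨a, b, c, rfl, rfl, rfl⟩ := key r s t h
    exact ⟨a, b, c, rfl, .g⟩
  | h r s t =>
    obtain ⟨a, b, c, rfl, rfl, rfl⟩ := key r s t h
    exact ⟨a, b, c, rfl, .h⟩

theorem nodup_rotate {a b c d e : Fin 5} (h : [a, b, c, d, e].Nodup) : [c, d, e, a, b].Nodup := by
  simp at *; tauto

/-- The possible positions of the inner monomial in a monomial of degree 5. -/
theorem TernaryMonomial.exists_cubic (T : TernaryOps F V) (x : Fin 5 → V)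
    {r s t : TernaryMonomial (Fin 5)} (hl : (r.args ++ s.args ++ t.args).length = 5)
    (hn : (r.args ++ s.args ++ t.args).Nodup) :
    ∃ a b c d e z, [a, b, c, d, e].Nodup ∧ T.IsCubic (x a) (x b) (x c) z ∧
      (r.eval T x = z ∧ s.eval T x = x d ∧ t.eval T x = x e ∨
        r.eval T x = x d ∧ s.eval T x = z ∧ t.eval T x = x e ∨
        r.eval T x = x d ∧ s.eval T x = x e ∧ t.eval T x = z) := by
  have hr := r.length_args_mod_two
  have hs := s.length_args_mod_two
  have ht := t.length_args_mod_two
  simp only [List.length_append] at hl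
  have : r.args.length = 3 ∧ s.args.length = 1 ∧ t.args.length = 1 ∨
      r.args.length = 1 ∧ s.args.length = 3 ∧ t.args.length = 1 ∨
      r.args.length = 1 ∧ s.args.length = 1 ∧ t.args.length = 3 := by omega
  rcases this with ⟨hr, hs, ht⟩ | ⟨hr, hs, ht⟩ | ⟨hr, hs, ht⟩
  · obtain ⟨a, b, c, h, hz⟩ := r.isCubic_of_length T x hr
    obtain ⟨d, rfl⟩ := s.exists_var_of_length hs
    obtain ⟨e, rfl⟩ := t.exists_var_of_length ht
    rw [h] at hn
    exact ⟨a, b, c, d, e, _, hn, hz, Or.inl ⟨rfl, rfl, rfl⟩⟩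
  · obtain ⟨a, b, c, h, hz⟩ := s.isCubic_of_length T x hs
    obtain ⟨d, rfl⟩ := r.exists_var_of_length hr
    obtain ⟨e, rfl⟩ := t.exists_var_of_length ht
    rw [h] at hn
    refine ⟨a, b, c, d, e, _, ?_, hz, Or.inr (Or.inl ⟨rfl, rfl, rfl⟩)⟩
    simp [args] at *; tauto
  · obtain ⟨a, b, c, h, hz⟩ := t.isCubic_of_length T x ht
    obtain ⟨d, rfl⟩ := r.exists_var_of_length hr
    obtain ⟨e, rfl⟩ := s.exists_var_of_length hs
    rw [h] at hn
    refine ⟨a, b, c, d, e, _, ?_, hz, Or.inr (Or.inr ⟨rfl, rfl, rfl⟩)⟩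
    simp [args] at *; tauto

/-- All degrees are odd, so in degree 5 one argument of the outer operation is cubic and the other
two are variables. The symmetries bring the cubic argument to first place, except that for `g` it
may also stay in last place. -/
theorem TernaryOps.TypesMem.eval_mem (hT : T.IsSymmetric) (H : T.TypesMem U x)
    {m : TernaryMonomial (Fin 5)} (hm : m.IsMultilinear) : m.eval T x ∈ U := by
  have hp := perm_finRange_of_isMultilinear hm
  have hl : m.args.length = 5 := hp.length_eq.trans (List.length_finRange)
  have hn : m.args.Nodup := hp.nodup_iff.2 (List.nodup_finRange 5)
  cases m with
  | var i => simp [TernaryMonomial.args] at hl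
  | f r s t =>
    obtain ⟨a, b, c, d, e, z, hn, hz, h⟩ := TernaryMonomial.exists_cubic T x hl hn
    have hz : T.f z (x d) (x e) ∈ U := by
      cases hz
      exacts [H.ff _ _ _ _ _ hn, H.fg _ _ _ _ _ hn, H.fh _ _ _ _ _ hn]
    rw [TernaryMonomial.eval]
    rcases h with ⟨h1, h2, h3⟩ | ⟨h1, h2, h3⟩ | ⟨h1, h2, h3⟩ <;> rw [h1, h2, h3]
    · exact hz
    · rwa [hT.f_swap₁₂]
    · rwa [hT.f_swap₂₃, hT.f_swap₁₂]
  | g r s t =>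
    obtain ⟨a, b, c, d, e, z, hn, hz, h⟩ := TernaryMonomial.exists_cubic T x hl hn
    -- One rotation shifts by two places; four of them shift by eight, which is three modulo five.
    have hn' : [d, e, a, b, c].Nodup := nodup_rotate (nodup_rotate (nodup_rotate
      (nodup_rotate hn)))
    have hz : T.g z (x d) (x e) ∈ U ∧ T.g (x d) (x e) z ∈ U := by
      cases hz
      exacts [⟨H.gf _ _ _ _ _ hn, H.gf' _ _ _ _ _ hn'⟩,
        ⟨H.gg _ _ _ _ _ hn, H.gg' _ _ _ _ _ hn'⟩, ⟨H.gh _ _ _ _ _ hn, H.gh' _ _ _ _ _ hn'⟩]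
    rw [TernaryMonomial.eval]
    rcases h with ⟨h1, h2, h3⟩ | ⟨h1, h2, h3⟩ | ⟨h1, h2, h3⟩ <;> rw [h1, h2, h3]
    · exact hz.1
    · rw [hT.g_swap]
      exact U.neg_mem hz.1
    · exact hz.2
  | h r s t =>
    obtain ⟨a, b, c, d, e, z, hn, hz, h⟩ := TernaryMonomial.exists_cubic T x hl hn
    have hn' : [a, b, c, e, d].Nodup := by simp at *; tauto
    have hz : T.h z (x d) (x e) ∈ U ∧ T.h z (x e) (x d) ∈ U := by
      cases hz
      exacts [⟨H.hf _ _ _ _ _ hn, H.hf _ _ _ _ _ hn'⟩,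
        ⟨H.hg _ _ _ _ _ hn, H.hg _ _ _ _ _ hn'⟩, ⟨H.hh _ _ _ _ _ hn, H.hh _ _ _ _ _ hn'⟩]
    rw [TernaryMonomial.eval]
    rcases h with ⟨h1, h2, h3⟩ | ⟨h1, h2, h3⟩ | ⟨h1, h2, h3⟩ <;> rw [h1, h2, h3]
    · exact hz.1
    · rw [hT.h_swap]
      exact U.neg_mem hz.1
    · rw [hT.h_jacobi]
      exact U.sub_mem hz.2 hz.1

end Symmetric

/-! ### Sorting arguments by the symmetries -/

section Sorting

variable {F : Type u} [Field F] {V : Type v} [AddCommGroup V] [Module F V] {U : Submodule F V}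

/-- The permutation supplied to `H` lets distinctness of all five arguments pass to the sorted ones.
-/
theorem mem_of_symm₂ {φ : Fin 5 → Fin 5 → V} (h : ∀ a b, φ a b = φ b a ∨ φ a b = -φ b a)
    {a b : Fin 5} (hab : a ≠ b)
    (H : ∀ a' b', [a', b'].Perm [a, b] → a' < b' → φ a' b' ∈ U) : φ a b ∈ U := by
  rcases lt_or_gt_of_ne hab with h' | h'
  · exact H a b (.refl _) h'
  · have h'' := H b a (.swap _ _ _) h'
    rcases h a b with e | e <;> rw [e]
    exacts [h'', U.neg_mem h'']

theorem mem_of_symm₃ {φ : Fin 5 → Fin 5 → Fin 5 → V} (h₁₂ : ∀ a b c, φ a b c = φ b a c)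
    (h₂₃ : ∀ a b c, φ a b c = φ a c b) {a b c : Fin 5} (hab : a ≠ b) (hbc : b ≠ c) (hac : a ≠ c)
    (H : ∀ a' b' c', [a', b', c'].Perm [a, b, c] → a' < b' → b' < c' → φ a' b' c' ∈ U) :
    φ a b c ∈ U := by
  have p₁ : ∀ a b c : Fin 5, [b, a, c].Perm [a, b, c] := fun a b c => .swap _ _ _
  have p₂ : ∀ a b c : Fin 5, [a, c, b].Perm [a, b, c] := fun a b c => (List.Perm.swap _ _ _).cons a
  rcases lt_or_gt_of_ne hab with h1 | h1 <;> rcases lt_or_gt_of_ne hbc with h2 | h2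
  · exact H _ _ _ (.refl _) h1 h2
  · rw [h₂₃]
    rcases lt_or_gt_of_ne hac with h3 | h3
    · exact H _ _ _ (p₂ a b c) h3 h2
    · rw [h₁₂]
      exact H _ _ _ ((p₁ a c b).trans (p₂ a b c)) h3 h1
  · rw [h₁₂]
    rcases lt_or_gt_of_ne hac with h3 | h3
    · exact H _ _ _ (p₁ a b c) h1 h3
    · rw [h₂₃]
      exact H _ _ _ ((p₂ b a c).trans (p₁ a b c)) h2 h3
  · rw [h₁₂, h₂₃, h₁₂]
    exact H _ _ _ (((p₁ b c a).trans (p₂ b a c)).trans (p₁ a b c)) h2 h1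

/-- Only the least argument has to reach the front: anticommutativity moves it from second place,
the Jacobi rule from third. -/
theorem mem_of_jacobi {φ : Fin 5 → Fin 5 → Fin 5 → V} (h₁₂ : ∀ a b c, φ a b c = -φ b a c)
    (h₁₃ : ∀ a b c, φ a b c = φ c b a - φ c a b) {a b c : Fin 5} (hab : a ≠ b) (hbc : b ≠ c)
    (hac : a ≠ c)
    (H : ∀ a' b' c', [a', b', c'].Perm [a, b, c] → a' < b' → a' < c' → φ a' b' c' ∈ U) :
    φ a b c ∈ U := by
  have p₁ : ∀ a b c : Fin 5, [b, a, c].Perm [a, b, c] := fun a b c => .swap _ _ _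
  have p₂ : ∀ a b c : Fin 5, [a, c, b].Perm [a, b, c] := fun a b c => (List.Perm.swap _ _ _).cons a
  have : a < b ∧ a < c ∨ b < a ∧ b < c ∨ c < a ∧ c < b := by grind
  rcases this with ⟨h1, h2⟩ | ⟨h1, h2⟩ | ⟨h1, h2⟩
  · exact H _ _ _ (.refl _) h1 h2
  · rw [h₁₂]
    exact U.neg_mem (H _ _ _ (p₁ a b c) h1 h2)
  · rw [h₁₃]
    have p := (p₁ a c b).trans (p₂ a b c)
    exact U.sub_mem (H _ _ _ ((p₂ c a b).trans p) h2 h1) (H _ _ _ p h1 h2)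

end Sorting

/-! ### Reduction of the twelve association types to the ternary table -/

section Tables

variable {F : Type u} [Field F] {V : Type v} [AddCommGroup V] [Module F V]
  {T : TernaryOps F V} {U : Submodule F V} {x : Fin 5 → V}

theorem TernaryOps.IsSymmetric.typesMem_of_table (hT : T.IsSymmetric)
    (H : ∀ j : TernaryIndex, ((ternaryType j.1.1).rename j.1.2).eval T x ∈ U) :
    T.TypesMem U x := by
  have key : ∀ (i : Fin 12) {a b c d e : Fin 5}, [a, b, c, d, e].Nodup →
      (∀ σ : Equiv.Perm (Fin 5), σ 0 = a ∧ σ 1 = b ∧ σ 2 = c ∧ σ 3 = d ∧ σ 4 = e →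
        ternaryOrder i σ = true) →
      (ternaryType i).eval T (x ∘ ![a, b, c, d, e]) ∈ U := by
    intro i a b c d e hn ho
    obtain ⟨σ, hσ⟩ := exists_perm_of_nodup hn
    have h := H ⟨(i, σ), ho σ hσ⟩
    have hσ' : ⇑σ = ![a, b, c, d, e] := by
      ext k
      fin_cases k <;> simp [hσ]
    rwa [TernaryMonomial.eval_rename, hσ'] at h
  refine ⟨?_, ?_, ?_, ?_, ?_, ?_, ?_, ?_, ?_, ?_, ?_, ?_⟩ <;> intro a b c d e hn <;>
    have hne := hn <;> simp [not_or] at hne <;>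
    obtain ⟨⟨hab, hac, had, hae⟩, ⟨hbc, hbd, hbe⟩, ⟨hcd, hce⟩, hde⟩ := hne
  · refine mem_of_symm₃ (φ := fun a b c => T.f (T.f (x a) (x b) (x c)) (x d) (x e))
      (fun a b c => by rw [hT.f_swap₁₂ (x a)])
      (fun a b c => by rw [hT.f_swap₂₃ (x a)]) hab hbc hac
      fun a b c hp h1 h2 => ?_
    refine mem_of_symm₂ (φ := fun d e => T.f (T.f (x a) (x b) (x c)) (x d) (x e))
      (fun d e => Or.inl (hT.f_swap₂₃ _ _ _)) hde fun d e hq h3 => ?_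
    exact key 0 ((hp.append hq).nodup_iff.2 hn) fun σ hσ => by simp [ternaryOrder, *]
  · refine mem_of_symm₂ (φ := fun a b => T.f (T.g (x a) (x b) (x c)) (x d) (x e))
      (fun a b => Or.inr (by rw [hT.g_swap (x a)]; simp)) hab
      fun a b hp h1 => ?_
    refine mem_of_symm₂ (φ := fun d e => T.f (T.g (x a) (x b) (x c)) (x d) (x e))
      (fun d e => Or.inl (hT.f_swap₂₃ _ _ _)) hde fun d e hq h3 => ?_
    exact key 1 ((hp.append (hq.cons c)).nodup_iff.2 hn) fun σ hσ => by simp [ternaryOrder, *]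
  · refine mem_of_jacobi (φ := fun a b c => T.f (T.h (x a) (x b) (x c)) (x d) (x e))
      (fun a b c => by rw [hT.h_swap (x a)]; simp)
      (fun a b c => by rw [hT.h_jacobi (x a)]; simp) hab hbc hac
      fun a b c hp h1 h2 => ?_
    refine mem_of_symm₂ (φ := fun d e => T.f (T.h (x a) (x b) (x c)) (x d) (x e))
      (fun d e => Or.inl (hT.f_swap₂₃ _ _ _)) hde fun d e hq h3 => ?_
    exact key 2 ((hp.append hq).nodup_iff.2 hn) fun σ hσ => by simp [ternaryOrder, *]
  · refine mem_of_symm₃ (φ := fun a b c => T.g (T.f (x a) (x b) (x c)) (x d) (x e))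
      (fun a b c => by rw [hT.f_swap₁₂ (x a)])
      (fun a b c => by rw [hT.f_swap₂₃ (x a)]) hab hbc hac
      fun a b c hp h1 h2 => ?_
    exact key 3 ((hp.append_right [d, e]).nodup_iff.2 hn) fun σ hσ => by simp [ternaryOrder, *]
  · refine mem_of_symm₃ (φ := fun c d e => T.g (x a) (x b) (T.f (x c) (x d) (x e)))
      (fun c d e => by rw [hT.f_swap₁₂ (x c)])
      (fun c d e => by rw [hT.f_swap₂₃ (x c)]) hcd hde hce
      fun c d e hp h1 h2 => ?_
    refine mem_of_symm₂ (φ := fun a b => T.g (x a) (x b) (T.f (x c) (x d) (x e)))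
      (fun a b => Or.inr (hT.g_swap _ _ _)) hab fun a b hq h3 => ?_
    exact key 4 ((hq.append hp).nodup_iff.2 hn) fun σ hσ => by simp [ternaryOrder, *]
  · refine mem_of_symm₂ (φ := fun a b => T.g (T.g (x a) (x b) (x c)) (x d) (x e))
      (fun a b => Or.inr (by rw [hT.g_swap (x a)]; simp)) hab
      fun a b hp h1 => ?_
    exact key 5 ((hp.append_right [c, d, e]).nodup_iff.2 hn) fun σ hσ => by simp [ternaryOrder, *]
  · refine mem_of_symm₂ (φ := fun a b => T.g (x a) (x b) (T.g (x c) (x d) (x e)))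
      (fun a b => Or.inr (hT.g_swap _ _ _)) hab fun a b hp h1 => ?_
    refine mem_of_symm₂ (φ := fun c d => T.g (x a) (x b) (T.g (x c) (x d) (x e)))
      (fun c d => Or.inr (by rw [hT.g_swap (x c)]; simp)) hcd
      fun c d hq h3 => ?_
    exact key 6 ((hp.append (hq.append_right [e])).nodup_iff.2 hn)
      fun σ hσ => by simp [ternaryOrder, *]
  · refine mem_of_jacobi (φ := fun a b c => T.g (T.h (x a) (x b) (x c)) (x d) (x e))
      (fun a b c => by rw [hT.h_swap (x a)]; simp)
      (fun a b c => by rw [hT.h_jacobi (x a)]; simp) hab hbc hac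
      fun a b c hp h1 h2 => ?_
    exact key 7 ((hp.append_right [d, e]).nodup_iff.2 hn) fun σ hσ => by simp [ternaryOrder, *]
  · refine mem_of_jacobi (φ := fun c d e => T.g (x a) (x b) (T.h (x c) (x d) (x e)))
      (fun c d e => by rw [hT.h_swap (x c)]; simp)
      (fun c d e => by rw [hT.h_jacobi (x c)]; simp) hcd hde hce
      fun c d e hp h1 h2 => ?_
    refine mem_of_symm₂ (φ := fun a b => T.g (x a) (x b) (T.h (x c) (x d) (x e)))
      (fun a b => Or.inr (hT.g_swap _ _ _)) hab fun a b hq h3 => ?_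
    exact key 8 ((hq.append hp).nodup_iff.2 hn) fun σ hσ => by simp [ternaryOrder, *]
  · refine mem_of_symm₃ (φ := fun a b c => T.h (T.f (x a) (x b) (x c)) (x d) (x e))
      (fun a b c => by rw [hT.f_swap₁₂ (x a)])
      (fun a b c => by rw [hT.f_swap₂₃ (x a)]) hab hbc hac
      fun a b c hp h1 h2 => ?_
    exact key 9 ((hp.append_right [d, e]).nodup_iff.2 hn) fun σ hσ => by simp [ternaryOrder, *]
  · refine mem_of_symm₂ (φ := fun a b => T.h (T.g (x a) (x b) (x c)) (x d) (x e))
      (fun a b => Or.inr (by rw [hT.g_swap (x a)]; simp)) hab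
      fun a b hp h1 => ?_
    exact key 10 ((hp.append_right [c, d, e]).nodup_iff.2 hn)
      fun σ hσ => by simp [ternaryOrder, *]
  · refine mem_of_jacobi (φ := fun a b c => T.h (T.h (x a) (x b) (x c)) (x d) (x e))
      (fun a b c => by rw [hT.h_swap (x a)]; simp)
      (fun a b c => by rw [hT.h_jacobi (x a)]; simp) hab hbc hac
      fun a b c hp h1 h2 => ?_
    exact key 11 ((hp.append_right [d, e]).nodup_iff.2 hn) fun σ hσ => by simp [ternaryOrder, *]

end Tables

/-! ### Reduction of T(5) to 120 monomials modulo the relations -/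

/-- Ternary monomials whose expansions are the monomials of the Poisson table. -/
def poissonLift : Fin 7 → TernaryMonomial (Fin 5) := fun i =>
  match i with
  | 0 => .h (.h (.var 0) (.var 1) (.var 2)) (.var 3) (.var 4)
  | 1 => .g (.h (.var 0) (.var 1) (.var 2)) (.var 3) (.var 4)
  | 2 => .g (.var 3) (.var 4) (.h (.var 0) (.var 1) (.var 2))
  | 3 => .f (.h (.var 0) (.var 1) (.var 2)) (.var 3) (.var 4)
  | 4 => .g (.var 0) (.var 1) (.g (.var 2) (.var 3) (.var 4))
  | 5 => .g (.var 0) (.var 1) (.f (.var 2) (.var 3) (.var 4))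
  | 6 => .f (.f (.var 0) (.var 1) (.var 2)) (.var 3) (.var 4)

theorem poissonLift_isMultilinear (i : Fin 7) : (poissonLift i).IsMultilinear := by
  unfold TernaryMonomial.IsMultilinear
  revert i
  decide

section Reduction

variable {F : Type u} [Field F] {V : Type v} [AddCommGroup V] [Module F V]
  {T : TernaryOps F V} {U : Submodule F V} {x : Fin 5 → V}

/-- The relations with distinct arguments, and the lifts of the Poisson table, lie in `U`. -/
structure TernaryOps.ReductionData (T : TernaryOps F V) (U : Submodule F V) (x : Fin 5 → V) :
    Prop where
  symm : T.IsSymmetric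
  relation_mem : ∀ (i : Fin 9) (a b c d e : Fin 5), [a, b, c, d, e].Nodup →
    T.relation i (x a) (x b) (x c) (x d) (x e) ∈ U
  lift_mem : ∀ j : PoissonIndex, ((poissonLift j.1.1).rename j.1.2).eval T x ∈ U

namespace TernaryOps.ReductionData

theorem lift_eval_mem (H : T.ReductionData U x) (i : Fin 7) {a b c d e : Fin 5}
    (hn : [a, b, c, d, e].Nodup)
    (ho : ∀ σ : Equiv.Perm (Fin 5), σ 0 = a ∧ σ 1 = b ∧ σ 2 = c ∧ σ 3 = d ∧ σ 4 = e →
      poissonOrder i σ = true) :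
    (poissonLift i).eval T (x ∘ ![a, b, c, d, e]) ∈ U := by
  obtain ⟨σ, hσ⟩ := exists_perm_of_nodup hn
  have h := H.lift_mem ⟨(i, σ), ho σ hσ⟩
  have hσ' : ⇑σ = ![a, b, c, d, e] := by
    ext k
    fin_cases k <;> simp [hσ]
  rwa [TernaryMonomial.eval_rename, hσ'] at h

/-- The first relation, taken twice, with `c` and `d` exchanged, and combined with the symmetry of
the inner product, allows exchanging `c` and `d`. If c > d this lowers the sum of the inner indices,
so the induction stops at the fully sorted monomial. -/
theorem ff_mem (H : T.ReductionData U x) {a b c d e : Fin 5} (hn : [a, b, c, d, e].Nodup) :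
    T.f (T.f (x a) (x b) (x c)) (x d) (x e) ∈ U := by
  have hT := H.symm
  induction hs : (a : ℕ) + b + c using Nat.strong_induction_on generalizing a b c d e with
  | _ n ih =>
    subst hs
    have hne := hn
    simp [not_or] at hne
    obtain ⟨⟨hab, hac, had, hae⟩, ⟨hbc, hbd, hbe⟩, ⟨hcd, hce⟩, hde⟩ := hne
    refine mem_of_symm₃ (φ := fun a b c => T.f (T.f (x a) (x b) (x c)) (x d) (x e))
      (fun a b c => by rw [hT.f_swap₁₂ (x a)])
      (fun a b c => by rw [hT.f_swap₂₃ (x a)]) hab hbc hac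
      fun a' b' c' hp h1 h2 => ?_
    refine mem_of_symm₂ (φ := fun d e => T.f (T.f (x a') (x b') (x c')) (x d) (x e))
      (fun d e => Or.inl (hT.f_swap₂₃ _ _ _)) hde fun d' e' hq h3 => ?_
    have hn' : [a', b', c', d', e'].Nodup := (hp.append hq).nodup_iff.2 hn
    have hsum : (a' : ℕ) + b' + c' = a + b + c := by
      have := (hp.map Fin.val).sum_eq
      simp at this
      omega
    have hcd' : c' ≠ d' := by simp at hn'; tauto
    rcases lt_or_gt_of_ne hcd' with h | h
    · exact H.lift_eval_mem 6 hn' fun σ hσ => by simp [poissonOrder, *]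
    · have hn'' : [a', b', d', c', e'].Nodup := by simp at hn' ⊢; tauto
      have h4 := H.relation_mem 0 _ _ _ _ _ hn'
      have h5 := H.relation_mem 0 _ _ _ _ _ hn''
      have h6 := ih _ (by rw [← hsum]; simpa using h) hn'' rfl
      simp only [TernaryOps.relation] at h4 h5
      rw [hT.f_swap₁₂ (x d')] at h5
      have h7 := U.add_mem (U.sub_mem h4 h5) h6
      convert h7 using 1
      module

theorem gfr_mem (H : T.ReductionData U x) {a b c d e : Fin 5} (hn : [a, b, c, d, e].Nodup) :
    T.g (x a) (x b) (T.f (x c) (x d) (x e)) ∈ U := by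
  have hT := H.symm
  have hne := hn
  simp [not_or] at hne
  obtain ⟨⟨hab, hac, had, hae⟩, ⟨hbc, hbd, hbe⟩, ⟨hcd, hce⟩, hde⟩ := hne
  refine mem_of_symm₃ (φ := fun c d e => T.g (x a) (x b) (T.f (x c) (x d) (x e)))
    (fun c d e => by rw [hT.f_swap₁₂ (x c)])
    (fun c d e => by rw [hT.f_swap₂₃ (x c)]) hcd hde hce
    fun c d e hp h1 h2 => ?_
  refine mem_of_symm₂ (φ := fun a b => T.g (x a) (x b) (T.f (x c) (x d) (x e)))
    (fun a b => Or.inr (hT.g_swap _ _ _)) hab fun a b hq h3 => ?_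
  exact H.lift_eval_mem 5 ((hq.append hp).nodup_iff.2 hn) fun σ hσ => by simp [poissonOrder, *]

theorem fg_mem (H : T.ReductionData U x) {a b c d e : Fin 5} (hn : [a, b, c, d, e].Nodup) :
    T.f (T.g (x a) (x b) (x c)) (x d) (x e) ∈ U :=
  (U.sub_mem_iff_left (H.gfr_mem hn)).1 (H.relation_mem 1 _ _ _ _ _ hn)

theorem gf_mem (H : T.ReductionData U x) {a b c d e : Fin 5} (hn : [a, b, c, d, e].Nodup) :
    T.g (T.f (x a) (x b) (x c)) (x d) (x e) ∈ U := by
  refine (U.sub_mem_iff_left ?_).1 (H.relation_mem 4 _ _ _ _ _ hn)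
  refine U.add_mem (U.add_mem ?_ ?_) ?_ <;> exact H.gfr_mem (by simp at *; tauto)

theorem fh_mem (H : T.ReductionData U x) {a b c d e : Fin 5} (hn : [a, b, c, d, e].Nodup) :
    T.f (T.h (x a) (x b) (x c)) (x d) (x e) ∈ U := by
  have hT := H.symm
  have hne := hn
  simp [not_or] at hne
  obtain ⟨⟨hab, hac, had, hae⟩, ⟨hbc, hbd, hbe⟩, ⟨hcd, hce⟩, hde⟩ := hne
  refine mem_of_jacobi (φ := fun a b c => T.f (T.h (x a) (x b) (x c)) (x d) (x e))
    (fun a b c => by rw [hT.h_swap (x a)]; simp)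
    (fun a b c => by rw [hT.h_jacobi (x a)]; simp) hab hbc hac
    fun a b c hp h1 h2 => ?_
  refine mem_of_symm₂ (φ := fun d e => T.f (T.h (x a) (x b) (x c)) (x d) (x e))
    (fun d e => Or.inl (hT.f_swap₂₃ _ _ _)) hde fun d e hq h3 => ?_
  exact H.lift_eval_mem 3 ((hp.append hq).nodup_iff.2 hn) fun σ hσ => by simp [poissonOrder, *]

/-- The third relation exchanges the pairs `(a, b)` and `(c, d)`, which supplies the remaining
condition a < c of the lift. -/
theorem ggr_mem (H : T.ReductionData U x) {a b c d e : Fin 5} (hn : [a, b, c, d, e].Nodup) :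
    T.g (x a) (x b) (T.g (x c) (x d) (x e)) ∈ U := by
  have hT := H.symm
  have hne := hn
  simp [not_or] at hne
  obtain ⟨⟨hab, hac, had, hae⟩, ⟨hbc, hbd, hbe⟩, ⟨hcd, hce⟩, hde⟩ := hne
  refine mem_of_symm₂ (φ := fun a b => T.g (x a) (x b) (T.g (x c) (x d) (x e)))
    (fun a b => Or.inr (hT.g_swap _ _ _)) hab fun a b hp h1 => ?_
  refine mem_of_symm₂ (φ := fun c d => T.g (x a) (x b) (T.g (x c) (x d) (x e)))
    (fun c d => Or.inr (by rw [hT.g_swap (x c)]; simp)) hcd fun c d hq h2 => ?_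
  have hn' : [a, b, c, d, e].Nodup := (hp.append (hq.append_right [e])).nodup_iff.2 hn
  have hac' : a ≠ c := by simp at hn'; tauto
  have hn'' : [c, d, a, b, e].Nodup := by simp at hn' ⊢; tauto
  rcases lt_or_gt_of_ne hac' with h | h
  · exact H.lift_eval_mem 4 hn' fun σ hσ => by simp [poissonOrder, *]
  · refine (U.sub_mem_iff_left ?_).1 (H.relation_mem 2 _ _ _ _ _ hn')
    exact H.lift_eval_mem 4 hn'' fun σ hσ => by simp [poissonOrder, *]

/-- The fourth relation is solved for this term; its other two terms have types already reduced. -/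
theorem gg_mem (H : T.ReductionData U x) {a b c d e : Fin 5} (hn : [a, b, c, d, e].Nodup) :
    T.g (T.g (x a) (x b) (x c)) (x d) (x e) ∈ U := by
  have h := H.relation_mem 3 a b d e c (by simp at hn ⊢; tauto)
  rw [TernaryOps.relation, U.sub_mem_iff_right (H.fh_mem (by simp at hn ⊢; tauto)),
    U.add_mem_iff_left (H.ggr_mem (by simp at hn ⊢; tauto))] at h
  exact h

theorem hf_mem (H : T.ReductionData U x) {a b c d e : Fin 5} (hn : [a, b, c, d, e].Nodup) :
    T.h (T.f (x a) (x b) (x c)) (x d) (x e) ∈ U := by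
  refine (U.sub_mem_iff_left ?_).1 (H.relation_mem 8 _ _ _ _ _ hn)
  refine U.sub_mem (U.add_mem (U.sub_mem (U.add_mem (U.sub_mem ?_ ?_) ?_) ?_) ?_) ?_ <;>
    first
    | exact H.gg_mem (by simp at *; tauto)
    | exact H.ggr_mem (by simp at *; tauto)

theorem ghr_mem (H : T.ReductionData U x) {a b c d e : Fin 5} (hn : [a, b, c, d, e].Nodup) :
    T.g (x a) (x b) (T.h (x c) (x d) (x e)) ∈ U := by
  have hT := H.symm
  have hne := hn
  simp [not_or] at hne
  obtain ⟨⟨hab, hac, had, hae⟩, ⟨hbc, hbd, hbe⟩, ⟨hcd, hce⟩, hde⟩ := hne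
  refine mem_of_jacobi (φ := fun c d e => T.g (x a) (x b) (T.h (x c) (x d) (x e)))
    (fun c d e => by rw [hT.h_swap (x c)]; simp)
    (fun c d e => by rw [hT.h_jacobi (x c)]; simp) hcd hde hce
    fun c d e hp h1 h2 => ?_
  refine mem_of_symm₂ (φ := fun a b => T.g (x a) (x b) (T.h (x c) (x d) (x e)))
    (fun a b => Or.inr (hT.g_swap _ _ _)) hab fun a b hq h3 => ?_
  have hn' : [a, b, c, d, e].Nodup := (hq.append hp).nodup_iff.2 hn
  exact H.lift_eval_mem 2 (nodup_rotate hn') fun σ hσ => by simp [poissonOrder, *]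

theorem gh_mem_of_lt (H : T.ReductionData U x) {a b c d e : Fin 5} (hn : [a, b, c, d, e].Nodup)
    (h : b < a ∧ b < c ∧ b < d ∨ a < b ∧ a < c ∧ a < d) :
    T.g (T.h (x a) (x b) (x c)) (x d) (x e) ∈ U := by
  have key : ∀ {a b c d e : Fin 5}, [a, b, c, d, e].Nodup → a < b ∧ a < c ∧ a < d →
      T.g (T.h (x a) (x b) (x c)) (x d) (x e) ∈ U := fun hn h =>
    H.lift_eval_mem 1 hn fun σ hσ => by simp [poissonOrder, *]
  rcases h with h | h
  · rw [H.symm.h_swap (x a)]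
    simpa using key (by simp at hn ⊢; tauto) h
  · exact key hn h

/-- The least of `a`, `b`, `c`, `d` has to reach the first place. The symmetries do this from second
and third place; if it is `d`, the seventh relation rewrites the monomial with `d` in second place
in every term. -/
theorem gh_mem (H : T.ReductionData U x) {a b c d e : Fin 5} (hn : [a, b, c, d, e].Nodup) :
    T.g (T.h (x a) (x b) (x c)) (x d) (x e) ∈ U := by
  have hne := hn
  simp [not_or] at hne
  obtain ⟨⟨hab, hac, had, hae⟩, ⟨hbc, hbd, hbe⟩, ⟨hcd, hce⟩, hde⟩ := hne
  have : (b < a ∧ b < c ∧ b < d ∨ a < b ∧ a < c ∧ a < d) ∨ (c < a ∧ c < b ∧ c < d) ∨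
      (d < a ∧ d < b ∧ d < c) := by grind
  rcases this with h | h | h
  · exact H.gh_mem_of_lt hn h
  · rw [H.symm.h_jacobi (x a), map_sub, LinearMap.sub_apply, LinearMap.sub_apply]
    exact U.sub_mem (H.gh_mem_of_lt (by simp at hn ⊢; tauto) (by tauto))
      (H.gh_mem_of_lt (by simp at hn ⊢; tauto) (by tauto))
  · refine (U.sub_mem_iff_left ?_).1 (H.relation_mem 6 _ _ _ _ _ hn)
    refine U.add_mem (U.sub_mem (U.sub_mem ?_ ?_) ?_) ?_ <;>
      exact H.gh_mem_of_lt (by simp at hn ⊢; tauto) (by tauto)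

theorem hg_mem (H : T.ReductionData U x) {a b c d e : Fin 5} (hn : [a, b, c, d, e].Nodup) :
    T.h (T.g (x a) (x b) (x c)) (x d) (x e) ∈ U := by
  refine (U.sub_mem_iff_left ?_).1 (H.relation_mem 5 _ _ _ _ _ hn)
  refine U.sub_mem (U.sub_mem (U.sub_mem ?_ ?_) ?_) ?_ <;>
    first
    | exact H.gh_mem (by simp at hn ⊢; tauto)
    | exact H.ghr_mem (by simp at hn ⊢; tauto)

theorem hh_mem_of_zero (H : T.ReductionData U x) {a b c d e : Fin 5}
    (hn : [a, b, c, d, e].Nodup) (h : a = 0 ∨ b = 0 ∨ c = 0) :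
    T.h (T.h (x a) (x b) (x c)) (x d) (x e) ∈ U := by
  have key : ∀ {a b c d e : Fin 5}, [a, b, c, d, e].Nodup → a = 0 →
      T.h (T.h (x a) (x b) (x c)) (x d) (x e) ∈ U := by
    rintro a b c d e hn rfl
    -- The lift of type 0 needs its first letter least among all five, that is, equal to 0.
    refine H.lift_eval_mem 0 hn fun σ hσ => ?_
    simp [not_or] at hn
    simp [poissonOrder, hσ, Fin.pos_iff_ne_zero]
    tauto
  have key' : ∀ {a b c d e : Fin 5}, [a, b, c, d, e].Nodup → b = 0 →
      T.h (T.h (x a) (x b) (x c)) (x d) (x e) ∈ U := by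
    intro a b c d e hn h
    rw [H.symm.h_swap (x a)]
    simpa using key (by simp at hn ⊢; tauto) h
  rcases h with h | h | h
  · exact key hn h
  · exact key' hn h
  · rw [H.symm.h_jacobi (x a), map_sub, LinearMap.sub_apply, LinearMap.sub_apply]
    exact U.sub_mem (key (by simp at hn ⊢; tauto) h) (key (by simp at hn ⊢; tauto) h)

/-- The eighth relation with every inner bracket moved to first place by the symmetries, so that all
terms are left-normed. -/
theorem hh_relation_mem (H : T.ReductionData U x) {a b c d e : Fin 5}
    (hn : [a, b, c, d, e].Nodup) :
    T.h (T.h (x c) (x d) (x e)) (x b) (x a) - T.h (T.h (x c) (x d) (x e)) (x a) (x b)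
      - (T.h (T.h (x a) (x b) (x c)) (x d) (x e) - T.h (T.h (x a) (x b) (x d)) (x c) (x e)
        + (T.h (T.h (x a) (x b) (x e)) (x d) (x c) - T.h (T.h (x a) (x b) (x e)) (x c) (x d)))
      ∈ U := by
  have h := H.relation_mem 7 _ _ _ _ _ hn
  simp only [TernaryOps.relation] at h
  rwa [H.symm.h_jacobi (x a) (x b) (T.h _ _ _), H.symm.h_jacobi (x c) (x d) (T.h _ _ _),
    H.symm.h_swap (x c) (T.h _ _ _), ← sub_eq_add_neg] at h

/-- With a = 0, every term on the right has 0 in its inner bracket and is already reduced; what is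
left exchanges the last two arguments when one of them is 0. -/
theorem hh_swap_mem (H : T.ReductionData U x) {b c d e : Fin 5} (hn : [0, b, c, d, e].Nodup) :
    T.h (T.h (x c) (x d) (x e)) (x b) (x 0) - T.h (T.h (x c) (x d) (x e)) (x 0) (x b) ∈ U := by
  refine (U.sub_mem_iff_left ?_).1 (H.hh_relation_mem hn)
  refine U.add_mem (U.sub_mem ?_ ?_) (U.sub_mem ?_ ?_) <;>
    exact H.hh_mem_of_zero (by simp at hn ⊢; tauto) (by tauto)

/-- Now c = 0. Apart from the wanted term, the terms either have 0 in the inner bracket or form the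
difference treated by `hh_swap_mem`. -/
theorem hh_mem_of_fourth (H : T.ReductionData U x) {a b d e : Fin 5}
    (hn : [a, b, 0, d, e].Nodup) : T.h (T.h (x a) (x b) (x d)) (x 0) (x e) ∈ U := by
  have h := H.hh_relation_mem hn
  rw [U.sub_mem_iff_right (U.sub_mem (H.hh_mem_of_zero (by simp at hn ⊢; tauto) (by tauto))
      (H.hh_mem_of_zero (by simp at hn ⊢; tauto) (by tauto))),
    U.add_mem_iff_left (H.hh_swap_mem (by simp at hn ⊢; tauto)),
    U.sub_mem_iff_right (H.hh_mem_of_zero (by simp at hn ⊢; tauto) (by tauto))] at h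
  exact h

theorem hh_mem (H : T.ReductionData U x) {a b c d e : Fin 5} (hn : [a, b, c, d, e].Nodup) :
    T.h (T.h (x a) (x b) (x c)) (x d) (x e) ∈ U := by
  have : (a = 0 ∨ b = 0 ∨ c = 0) ∨ d = 0 ∨ e = 0 := by
    obtain ⟨σ, rfl, rfl, rfl, rfl, rfl⟩ := exists_perm_of_nodup hn
    obtain ⟨k, hk⟩ := σ.surjective 0
    fin_cases k <;> simp_all
  rcases this with h | rfl | rfl
  · exact H.hh_mem_of_zero hn h
  · exact H.hh_mem_of_fourth (by simp at hn ⊢; tauto)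
  · exact (U.sub_mem_iff_left (H.hh_mem_of_fourth (by simp at hn ⊢; tauto))).1
      (H.hh_swap_mem (by simp at hn ⊢; tauto))

theorem typesMem (H : T.ReductionData U x) : T.TypesMem U x where
  ff _ _ _ _ _ := H.ff_mem
  fg _ _ _ _ _ := H.fg_mem
  fh _ _ _ _ _ := H.fh_mem
  gf _ _ _ _ _ := H.gf_mem
  gf' _ _ _ _ _ := H.gfr_mem
  gg _ _ _ _ _ := H.gg_mem
  gg' _ _ _ _ _ := H.ggr_mem
  gh _ _ _ _ _ := H.gh_mem
  gh' _ _ _ _ _ := H.ghr_mem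
  hf _ _ _ _ _ := H.hf_mem
  hg _ _ _ _ _ := H.hg_mem
  hh _ _ _ _ _ := H.hh_mem

end TernaryOps.ReductionData

end Reduction

/-! ### Checking the symmetries on a basis -/

section Basis

variable {F : Type u} [Field F] {V : Type v} [AddCommGroup V] [Module F V] {ι : Type w}

theorem trilinear_ext_basis (b : Module.Basis ι F V) {Φ Ψ : V →ₗ[F] V →ₗ[F] V →ₗ[F] V}
    (h : ∀ r s t, Φ (b r) (b s) (b t) = Ψ (b r) (b s) (b t)) (x y z : V) :
    Φ x y z = Ψ x y z := by
  have : Φ = Ψ := b.ext fun r => b.ext fun s => b.ext fun t => h r s t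
  rw [this]

theorem TernaryOps.IsSymmetric.of_basis {T : TernaryOps F V} (b : Module.Basis ι F V)
    (f₁₂ : ∀ r s t, T.f (b r) (b s) (b t) = T.f (b s) (b r) (b t))
    (f₂₃ : ∀ r s t, T.f (b r) (b s) (b t) = T.f (b r) (b t) (b s))
    (g_swap : ∀ r s t, T.g (b r) (b s) (b t) = -T.g (b s) (b r) (b t))
    (h_swap : ∀ r s t, T.h (b r) (b s) (b t) = -T.h (b s) (b r) (b t))
    (h_jacobi : ∀ r s t, T.h (b r) (b s) (b t)
      = T.h (b t) (b s) (b r) - T.h (b t) (b r) (b s)) : T.IsSymmetric where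
  f_swap₁₂ := trilinear_ext_basis b (Ψ := T.f.flip) f₁₂
  f_swap₂₃ := trilinear_ext_basis b (Ψ := LinearMap.lflip.toLinearMap.comp T.f) f₂₃
  g_swap := trilinear_ext_basis b (Ψ := -T.g.flip) g_swap
  h_swap := trilinear_ext_basis b (Ψ := -T.h.flip) h_swap
  -- At `a`, `b`, `c` the two terms of `Ψ` are `T.h c b a` and `T.h c a b`.
  h_jacobi := trilinear_ext_basis b
    (Ψ := (LinearMap.lflip.toLinearMap.comp T.h.flip).flip
      - LinearMap.lflip.toLinearMap.comp T.h.flip) h_jacobi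

end Basis

/-! ### A model of the symmetries: operations that sort their arguments -/

section SortedOps

variable (F : Type u) [Field F] {α : Type v}

/-- The trilinear extension of a map defined on triples of basis elements. -/
noncomputable def trilinearLift (op : α → α → α → (α →₀ F)) :
    (α →₀ F) →ₗ[F] (α →₀ F) →ₗ[F] (α →₀ F) →ₗ[F] (α →₀ F) :=
  Finsupp.linearCombination F fun r =>
    Finsupp.linearCombination F fun s => Finsupp.linearCombination F fun t => op r s t

theorem trilinearLift_single (op : α → α → α → (α →₀ F)) (r s t : α) :
    trilinearLift F op (.single r 1) (.single s 1) (.single t 1) = op r s t := by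
  simp [trilinearLift]

variable [LinearOrder α]

/-- The normal forms of the values of the ternary operations on basis elements. -/
noncomputable def sortedOps (f g h : α → α → α → α) : TernaryOps F (α →₀ F) where
  f := trilinearLift F fun r s t =>
    -- The three arguments are the minimum, the median and the maximum.
    .single (f (min (min r s) t) (max (min r s) (min (max r s) t)) (max (max r s) t)) 1
  g := trilinearLift F fun r s t =>
    if r < s then .single (g r s t) 1 else if s < r then -.single (g s r t) 1 else 0
  h := trilinearLift F fun r s t =>
    -- The second inequality is weak because the symmetries do not force `h r s r` to vanish.
    if r < s ∧ r ≤ t then .single (h r s t) 1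
    else if s < r ∧ s ≤ t then -.single (h s r t) 1
    else if t < r ∧ t < s then .single (h t s r) 1 - .single (h t r s) 1
    else 0

theorem median_comm (r s t : α) :
    max (min r s) (min (max r s) t) = max (min r t) (min (max r t) s) := by
  rcases le_total r s with h1 | h1 <;> rcases le_total r t with h2 | h2 <;>
    rcases le_total s t with h3 | h3 <;> simp [*] <;> order

/-- This provides an algebra satisfying the symmetries in which monomials in normal form remain
distinct basis vectors. The symmetries are checked on basis elements, those of `g` and `h`
separately for each relative order of the arguments. -/
theorem sortedOps_isSymmetric (f g h : α → α → α → α) : (sortedOps F f g h).IsSymmetric := by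
  refine .of_basis Finsupp.basisSingleOne ?_ ?_ ?_ ?_ ?_ <;> intro r s t <;>
    simp only [Finsupp.coe_basisSingleOne, sortedOps, trilinearLift_single]
  · rw [min_comm s r, max_comm s r]
  · rw [min_right_comm r s t, max_right_comm r s t, median_comm]
  · rcases lt_trichotomy r s with h1 | h1 | h1 <;> simp [h1, h1.not_gt]
  · rcases lt_trichotomy r s with h1 | h1 | h1 <;> rcases lt_trichotomy r t with h2 | h2 | h2 <;>
      rcases lt_trichotomy s t with h3 | h3 | h3 <;>
      first | (exfalso; order) | simp [*, le_of_lt, not_lt_of_gt, not_le_of_gt]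
  · rcases lt_trichotomy r s with h1 | h1 | h1 <;> rcases lt_trichotomy r t with h2 | h2 | h2 <;>
      rcases lt_trichotomy s t with h3 | h3 | h3 <;>
      first
      | (exfalso; order)
      | (simp [*, le_of_lt, not_lt_of_gt, not_le_of_gt]; done)
      | (simp [*, le_of_lt, not_lt_of_gt, not_le_of_gt]; abel)

variable {f g h : α → α → α → α} {r s t : α}

theorem sortedOps_f (h₁ : r ≤ s) (h₂ : s ≤ t) :
    (sortedOps F f g h).f (.single r 1) (.single s 1) (.single t 1) = .single (f r s t) 1 := by
  simp [sortedOps, trilinearLift_single, h₁, h₂, h₁.trans h₂]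

theorem sortedOps_g (h₁ : r < s) :
    (sortedOps F f g h).g (.single r 1) (.single s 1) (.single t 1) = .single (g r s t) 1 := by
  simp [sortedOps, trilinearLift_single, h₁]

theorem sortedOps_h (h₁ : r < s) (h₂ : r ≤ t) :
    (sortedOps F f g h).h (.single r 1) (.single s 1) (.single t 1) = .single (h r s t) 1 := by
  simp [sortedOps, trilinearLift_single, h₁, h₂]

end SortedOps

/-! ### An order on monomials -/

section MonomialOrder

/-- The position of a monomial in the order: products precede variables. -/
def TernaryMonomial.level : TernaryMonomial (Fin 5) → ℕ
  | var i => i + 1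
  | _ => 0

/-- A linear order on monomials such that products precede variables. -/
@[reducible] noncomputable def monomialOrder : LinearOrder (TernaryMonomial (Fin 5)) :=
  -- Only products share a level, and an arbitrary well-order breaks those ties.
  letI : LinearOrder (TernaryMonomial (Fin 5)) := IsWellOrder.linearOrder WellOrderingRel
  LinearOrder.lift' (fun m => toLex (m.level, m)) fun _ _ h => congrArg (fun p => (ofLex p).2) h

attribute [local instance] monomialOrder

theorem lt_of_level_lt {m m' : TernaryMonomial (Fin 5)} (h : m.level < m'.level) : m < m' :=
  Prod.Lex.left (α := ℕ) _ _ h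

end MonomialOrder

/-! ### The basis of T(5) -/

section TernaryBasis

variable (F : Type u) [Field F]

attribute [local instance] monomialOrder

theorem TernaryMonomial.var_lt {i j : Fin 5} (h : i < j) :
    TernaryMonomial.var i < TernaryMonomial.var j :=
  lt_of_level_lt (Nat.succ_lt_succ h)

/-- Since products precede variables, the order conditions of the table ensure that every operation
meets its arguments in normal order, so a table monomial evaluates to itself. -/
theorem eval_table_sortedOps (j : TernaryIndex) :
    ((ternaryType j.1.1).rename j.1.2).eval
        (sortedOps F TernaryMonomial.f TernaryMonomial.g TernaryMonomial.h)
        (fun i => .single (.var i) 1)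
      = .single ((ternaryType j.1.1).rename j.1.2) 1 := by
  obtain ⟨⟨i, σ⟩, h⟩ := j
  have hv : ∀ {i j : Fin 5}, i < j → TernaryMonomial.var i < TernaryMonomial.var j :=
    TernaryMonomial.var_lt
  have hf : ∀ (r s t : TernaryMonomial (Fin 5)) (i : Fin 5), TernaryMonomial.f r s t < .var i :=
    fun r s t i => lt_of_level_lt (Nat.succ_pos _)
  have hg : ∀ (r s t : TernaryMonomial (Fin 5)) (i : Fin 5), TernaryMonomial.g r s t < .var i :=
    fun r s t i => lt_of_level_lt (Nat.succ_pos _)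
  have hh : ∀ (r s t : TernaryMonomial (Fin 5)) (i : Fin 5), TernaryMonomial.h r s t < .var i :=
    fun r s t i => lt_of_level_lt (Nat.succ_pos _)
  fin_cases i <;>
    simp only [ternaryOrder, Bool.and_eq_true, decide_eq_true_eq] at h <;>
    simp only [ternaryType, TernaryMonomial.rename, TernaryMonomial.eval]
  · rw [sortedOps_f F (hv h.1.1).le (hv h.1.2).le, sortedOps_f F (hf _ _ _ _).le (hv h.2).le]
  · rw [sortedOps_g F (hv h.1), sortedOps_f F (hg _ _ _ _).le (hv h.2).le]
  · rw [sortedOps_h F (hv h.1.1) (hv h.1.2).le, sortedOps_f F (hh _ _ _ _).le (hv h.2).le]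
  · rw [sortedOps_f F (hv h.1).le (hv h.2).le, sortedOps_g F (hf _ _ _ _)]
  · rw [sortedOps_f F (hv h.1.2).le (hv h.2).le, sortedOps_g F (hv h.1.1)]
  · rw [sortedOps_g F (hv h), sortedOps_g F (hg _ _ _ _)]
  · rw [sortedOps_g F (hv h.2), sortedOps_g F (hv h.1)]
  · rw [sortedOps_h F (hv h.1) (hv h.2).le, sortedOps_g F (hh _ _ _ _)]
  · rw [sortedOps_h F (hv h.1.2) (hv h.2).le, sortedOps_g F (hv h.1.1)]
  · rw [sortedOps_f F (hv h.1).le (hv h.2).le, sortedOps_h F (hf _ _ _ _) (hf _ _ _ _).le]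
  · rw [sortedOps_g F (hv h), sortedOps_h F (hg _ _ _ _) (hg _ _ _ _).le]
  · rw [sortedOps_h F (hv h.1) (hv h.2).le, sortedOps_h F (hh _ _ _ _) (hh _ _ _ _).le]

/-- The operations of a monomial in prefix notation. -/
def TernaryMonomial.shape {X : Type v} : TernaryMonomial X → List ℕ
  | var _ => [0]
  | f r s t => 1 :: (r.shape ++ s.shape ++ t.shape)
  | g r s t => 2 :: (r.shape ++ s.shape ++ t.shape)
  | h r s t => 3 :: (r.shape ++ s.shape ++ t.shape)

theorem TernaryMonomial.shape_rename {X : Type v} {Y : Type w} (σ : X → Y)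
    (m : TernaryMonomial X) : (m.rename σ).shape = m.shape := by
  induction m <;> simp_all [rename, shape]

theorem ternaryType_rename_injective {i j : Fin 12} {σ τ : Equiv.Perm (Fin 5)}
    (h : (ternaryType i).rename σ = (ternaryType j).rename τ) : i = j ∧ σ = τ := by
  constructor
  · have h' := congrArg TernaryMonomial.shape h
    rw [TernaryMonomial.shape_rename, TernaryMonomial.shape_rename] at h'
    clear h
    revert i j
    decide
  · have hargs : ∀ i, (ternaryType i).args = [0, 1, 2, 3, 4] := by decide
    have h' := congrArg TernaryMonomial.args h
    simp only [TernaryMonomial.args_rename, hargs, List.map_cons, List.cons.injEq] at h'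
    ext k
    fin_cases k <;> simp [h']

theorem linearIndependent_tableT : LinearIndependent F (tableT F) := by
  have hT := sortedOps_isSymmetric F (TernaryMonomial.f (X := Fin 5)) TernaryMonomial.g
    TernaryMonomial.h
  have h := (Finsupp.basisSingleOne (R := F) (ι := TernaryMonomial (Fin 5))).linearIndependent.comp
    (fun j : TernaryIndex => (ternaryType j.1.1).rename j.1.2) fun j k h =>
      Subtype.ext (Prod.ext (ternaryType_rename_injective h).1 (ternaryType_rename_injective h).2)
  rw [Finsupp.coe_basisSingleOne] at h
  have hL : (fun j => hT.lift (fun i => .single (.var i) 1) (tableT F j)) =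
      fun j => Finsupp.single ((ternaryType j.1.1).rename j.1.2) (1 : F) := by
    funext j
    rw [← eval_table_sortedOps F j, ← hT.lift_ternaryClass]
    rfl
  exact LinearIndependent.of_comp
    (hT.lift (fun i => .single (.var i) 1) ∘ₗ (multilinearT F 5).subtype)
    (hL.symm ▸ h : LinearIndependent F fun j : TernaryIndex =>
      hT.lift (fun i => .single (.var i) 1) (tableT F j))

theorem multilinearT_le_of_typesMem {U : Submodule F (FreeTernary F (Fin 5))}
    (H : (symmetricOps F (Fin 5)).TypesMem U fun i => ternaryClass F (.var i)) :
    multilinearT F 5 ≤ U := by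
  refine Submodule.span_le.2 ?_
  rintro _ ⟨m, hm, rfl⟩
  rw [ternaryClass_eq_eval]
  exact H.eval_mem (symmetricOps_isSymmetric F (Fin 5)) hm

theorem eq_top_of_le_map_subtype {M : Type*} [AddCommGroup M] [Module F M] {N : Submodule F M}
    {U : Submodule F N} (h : N ≤ U.map N.subtype) : U = ⊤ := by
  refine eq_top_iff.2 fun x _ => ?_
  obtain ⟨y, hy, e⟩ := h x.2
  rwa [← Subtype.ext e]

theorem span_tableT : Submodule.span F (Set.range (tableT F)) = ⊤ := by
  refine eq_top_of_le_map_subtype F (multilinearT_le_of_typesMem F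
    ((symmetricOps_isSymmetric F (Fin 5)).typesMem_of_table fun j => ?_))
  rw [← ternaryClass_eq_eval]
  exact ⟨tableT F j, Submodule.subset_span ⟨j, rfl⟩, rfl⟩

/-- The basis of `T(5)` given by the table. -/
noncomputable def basisT : Module.Basis TernaryIndex F (multilinearT F 5) :=
  .mk (linearIndependent_tableT F) (span_tableT F).ge

theorem basisT_apply (j : TernaryIndex) : basisT F j = tableT F j :=
  Module.Basis.mk_apply _ _ j

end TernaryBasis

/-! ### The kernel of the expansion map -/

section Kernel

variable (F : Type u) [Field F]

theorem isHom_mkQ_freePoisson (X : Type v) :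
    (freeBinaryOps F X).toTernary.IsHom (freePoisson F X).toTernary (poissonIdeal F X).mkQ := by
  have h1 := fun a b => quotientBilinear_mkQ (poissonIdeal_isIdeal F X).mul_mem a b
  have h2 := fun a b => quotientBilinear_mkQ (poissonIdeal_isIdeal F X).bracket_mem a b
  refine ⟨fun a b c => ?_, fun a b c => ?_, fun a b c => ?_⟩
  · exact ((congrArg (fun z => quotientBilinear _ _ z _) (h1 a b)).trans (h1 _ c)).symm
  · exact ((congrArg (fun z => quotientBilinear _ _ z _) (h2 a b)).trans (h1 _ c)).symm
  · exact ((congrArg (fun z => quotientBilinear _ _ z _) (h2 a b)).trans (h2 _ c)).symm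

/-- A translate of a relation under the symmetric group is the same relation at permuted generators,
so any algebra where the relations hold for all arguments kills N. -/
theorem coe_permute_relationT (σ : Equiv.Perm (Fin 5)) (i : Fin 9) :
    (permute F σ (relationT F i) : FreeTernary F (Fin 5)) =
      (symmetryIdeal F (Fin 5)).mkQ ((freeTernaryOps F (Fin 5)).relation i
        (.single (.var (σ 0)) 1) (.single (.var (σ 1)) 1) (.single (.var (σ 2)) 1)
        (.single (.var (σ 3)) 1) (.single (.var (σ 4)) 1)) := by
  change (symmetryIdeal F (Fin 5)).mkQ
    (Finsupp.lmapDomain F F (TernaryMonomial.rename σ) (relationPoly F i)) = _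
  rw [relationPoly, (rename_isHom F σ).map_relation]
  simp only [Finsupp.lmapDomain_apply, Finsupp.mapDomain_single, TernaryMonomial.rename]

theorem relationModule_le_ker : relationModule F ≤ LinearMap.ker (expansion F 5) := by
  refine Submodule.span_le.2 ?_
  rintro _ ⟨σ, i, rfl⟩
  refine Subtype.ext ?_
  change expandMap F (Fin 5) (permute F σ (relationT F i)).1 = 0
  rw [coe_permute_relationT]
  change (poissonIdeal F (Fin 5)).mkQ (Finsupp.lmapDomain F F TernaryMonomial.expand _) = 0
  rw [(expand_isHom F _).map_relation, (isHom_mkQ_freePoisson F _).map_relation]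
  exact (freePoisson F _).relation_eq_zero i _ _ _ _ _

/-- The multilinear ternary monomials whose expansions form the Poisson table. -/
noncomputable def liftP (j : PoissonIndex) : multilinearT F 5 :=
  monomialT F ((poissonLift j.1.1).rename j.1.2) ((poissonLift_isMultilinear j.1.1).rename j.1.2)

theorem expansion_liftP (j : PoissonIndex) : expansion F 5 (liftP F j) = tableP F j := by
  refine Subtype.ext ?_
  change expandMap F (Fin 5) (ternaryClass F _) = poissonClass F _
  rw [expandMap_ternaryClass, poissonClass_eq_eval,
    poissonClass_eq_eval F (BinaryMonomial.rename _ _)]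
  obtain ⟨⟨i, σ⟩, _⟩ := j
  have h := (freePoisson F (Fin 5)).mul_assoc
  have h' := (freePoisson F (Fin 5)).mul_comm
  fin_cases i <;>
    simp only [poissonLift, poissonType, TernaryMonomial.rename, BinaryMonomial.rename,
      TernaryMonomial.expand, BinaryMonomial.eval, h]
  -- Only type 2 remains: its lift has the two Lie factors in the opposite order.
  rw [h']

/-- The reduction is applied in the free algebra with symmetries, with this sum of subspaces as the
target. -/
theorem relationModule_sup_span_liftP :
    relationModule F ⊔ Submodule.span F (Set.range (liftP F)) = ⊤ := by
  refine eq_top_of_le_map_subtype F (multilinearT_le_of_typesMem F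
    (TernaryOps.ReductionData.typesMem ⟨symmetricOps_isSymmetric F (Fin 5), ?_, ?_⟩))
  · intro i a b c d e hn
    obtain ⟨σ, rfl, rfl, rfl, rfl, rfl⟩ := exists_perm_of_nodup hn
    refine ⟨permute F σ (relationT F i),
      Submodule.mem_sup_left (Submodule.subset_span ⟨σ, i, rfl⟩), ?_⟩
    rw [Submodule.subtype_apply, coe_permute_relationT,
      (symmetryIdeal_isIdeal F (Fin 5)).isHom_mkQ.map_relation]
    rfl
  · intro j
    rw [← ternaryClass_eq_eval]
    exact ⟨liftP F j, Submodule.mem_sup_right (Submodule.subset_span ⟨j, rfl⟩), rfl⟩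

/-- The lifts span a complement candidate on which the expansion map is injective, because their
images are linearly independent; with N inside the kernel, nothing else can lie in it. -/
theorem ker_expansion : LinearMap.ker (expansion F 5) = relationModule F := by
  refine le_antisymm (fun z hz => ?_) (relationModule_le_ker F)
  have hz' : z ∈ relationModule F ⊔ Submodule.span F (Set.range (liftP F)) := by
    rw [relationModule_sup_span_liftP]
    trivial
  obtain ⟨n, hn, y, hy, rfl⟩ := Submodule.mem_sup.1 hz'
  obtain ⟨c, rfl⟩ := (Submodule.mem_span_range_iff_exists_fun F).1 hy
  have h : ∑ j, c j • tableP F j = 0 := by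
    have h0 := relationModule_le_ker F hn
    rw [LinearMap.mem_ker] at hz h0
    simpa only [map_add, h0, zero_add, map_sum, map_smul, expansion_liftP] using hz
  have hc := Fintype.linearIndependent_iff.1 (linearIndependent_tableP F) c h
  simpa [hc] using hn

/-- Evaluation in a Poisson algebra factors through the expansion map, so a polynomial with zero
expansion is an identity of every Poisson algebra. -/
theorem evalPoly_toTernary {A : Type v} [AddCommGroup A] [Module F A] (P : PoissonAlgebra F A)
    {X : Type w} (x : X → A) (p : TernaryMonomial X →₀ F) :
    P.toTernary.evalPoly x p = P.lift x (expandMap F X ((symmetryIdeal F X).mkQ p)) := by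
  induction p using Finsupp.induction_linear with
  | zero => simp
  | add p q hp hq => rw [map_add, hp, hq, map_add, map_add, map_add]
  | single m c =>
    have h := P.lift_poissonClass x m.expand
    rw [← expandMap_ternaryClass, TernaryMonomial.eval_expand, ternaryClass] at h
    rw [← mul_one c, ← Finsupp.smul_single', map_smul, map_smul, map_smul, map_smul, h,
      Finsupp.linearCombination_single, one_smul]

theorem lift_freePoisson (X : Type w) (z : FreePoisson F X) :
    (freePoisson F X).lift (fun i => poissonClass F (.var i)) z = z := by
  obtain ⟨p, rfl⟩ := (poissonIdeal F X).mkQ_surjective z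
  induction p using Finsupp.induction_linear with
  | zero => simp
  | add p q hp hq => rw [map_add, map_add, hp, hq]
  | single m c =>
    have h := (freePoisson F X).lift_poissonClass (fun i => poissonClass F (.var i)) m
    rw [← poissonClass_eq_eval, poissonClass] at h
    rw [← mul_one c, ← Finsupp.smul_single', map_smul, map_smul, h]

theorem classT_mem_relationModule_iff (p : multilinearPoly F 5) :
    classT F 5 p ∈ relationModule F ↔
      expandMap F (Fin 5) ((symmetryIdeal F (Fin 5)).mkQ p.1) = 0 := by
  rw [← ker_expansion, LinearMap.mem_ker, ← Submodule.coe_eq_zero]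
  rfl

theorem IsPoissonTripleSystem.satisfies {V : Type v} [AddCommGroup V] [Module F V]
    {T : TernaryOps F V} (hT : T.IsPoissonTripleSystem) {p : multilinearPoly F 5}
    (hp : classT F 5 p ∈ relationModule F) : T.Satisfies p.1 := by
  intro x
  have h : relationModule F ≤
      LinearMap.ker (hT.isSymmetric.lift x ∘ₗ (multilinearT F 5).subtype) := by
    refine Submodule.span_le.2 ?_
    rintro _ ⟨σ, i, rfl⟩
    change hT.isSymmetric.lift x (permute F σ (relationT F i)).1 = 0
    rw [coe_permute_relationT, hT.isSymmetric.lift_mkQ, (T.isHom_evalPoly x).map_relation]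
    exact hT.relation_eq_zero i _ _ _ _ _
  exact h hp

theorem ker_toMatrix_mulVecLin {ι κ M N : Type*} [Fintype ι] [Fintype κ] [DecidableEq ι]
    [AddCommGroup M] [Module F M] [AddCommGroup N] [Module F N] (b : Module.Basis ι F M)
    (c : Module.Basis κ F N) (R : M →ₗ[F] N) :
    LinearMap.ker (LinearMap.toMatrix b c R).mulVecLin
      = (LinearMap.ker R).map b.equivFun.toLinearMap := by
  ext v
  obtain ⟨z, rfl⟩ := b.equivFun.surjective v
  have h : (LinearMap.toMatrix b c R).mulVec (b.equivFun z) = c.equivFun (R z) :=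
    LinearMap.toMatrix_mulVec_repr b c R z
  rw [LinearMap.mem_ker, Matrix.mulVecLin_apply, h, LinearEquiv.map_eq_zero_iff]
  simp [LinearMap.mem_ker]

end Kernel

theorem card_poissonIndex : Fintype.card PoissonIndex = 120 := by decide +kernel

theorem card_ternaryIndex : Fintype.card TernaryIndex = 360 := by decide +kernel

end PoissonTriple

/-! ### The main theorem -/

open PoissonTriple in
theorem mainTheorem1 (F : Type u) [Field F] [CharZero F] :
    -- the identities of Poisson algebras are exactly the consequences of the nine relations
    (∀ p : multilinearPoly F 5,
      (∀ (A : Type u) [AddCommGroup A] [Module F A] (P : PoissonAlgebra F A),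
        P.toTernary.Satisfies p.1) ↔ classT F 5 p ∈ relationModule F) ∧
    -- in particular they hold in every Poisson triple system
    (∀ p : multilinearPoly F 5,
      (∀ (A : Type u) [AddCommGroup A] [Module F A] (P : PoissonAlgebra F A),
        P.toTernary.Satisfies p.1) →
      ∀ (V : Type v) [AddCommGroup V] [Module F V] (T : TernaryOps F V),
        T.IsPoissonTripleSystem → T.Satisfies p.1) ∧
    -- the kernel of the expansion map
    LinearMap.ker (expansion F 5) = relationModule F ∧
    -- the kernel of the expansion matrix
    Fintype.card PoissonIndex = 120 ∧ Fintype.card TernaryIndex = 360 ∧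
    ∃ (bT : Module.Basis TernaryIndex F (multilinearT F 5))
      (bP : Module.Basis PoissonIndex F (multilinearP F 5)),
      (∀ j, bT j = tableT F j) ∧ (∀ i, bP i = tableP F i) ∧
      LinearMap.ker (LinearMap.toMatrix bT bP (expansion F 5)).mulVecLin
        = (relationModule F).map bT.equivFun.toLinearMap := by
  have key : ∀ p : multilinearPoly F 5,
      (∀ (A : Type u) [AddCommGroup A] [Module F A] (P : PoissonAlgebra F A),
        P.toTernary.Satisfies p.1) ↔ classT F 5 p ∈ relationModule F := by
    intro p
    rw [classT_mem_relationModule_iff]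
    refine ⟨fun h => ?_, fun h A _ _ P x => ?_⟩
    -- The identity is tested at the generators of the free Poisson algebra, where the value is the
    -- expansion itself.
    · have h' := h _ (freePoisson F (Fin 5)) fun i => poissonClass F (.var i)
      rw [← lift_freePoisson F (Fin 5) (expandMap F (Fin 5) _), ← evalPoly_toTernary]
      exact h'
    · have h' := evalPoly_toTernary F P x p.1
      rw [h, map_zero] at h'
      exact h'
  refine ⟨key, fun p hp V _ _ T hT => IsPoissonTripleSystem.satisfies F hT ((key p).1 hp),
    ker_expansion F, card_poissonIndex, card_ternaryIndex, basisT F, basisP F, basisT_apply F,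
    basisP_apply F, ?_⟩
  rw [ker_toMatrix_mulVecLin, ker_expansion]
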